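/- Let $d\ge 1$ and let $M_d$ be the algebra of complex $d\times d$ matrices, with trace norm $\|X\|_1$ (the sum of the singular values) and Hilbert--Schmidt norm $\|X\|_2=\operatorname{tr}(X^*X)^{1/2}$. Let $\mathcal S_d=\{\rho\in M_d:\rho\ge 0,\ \operatorname{tr}\rho=1\}$. A linear map $T:M_d\to M_d$ is bistochastic if it is completely positive, trace preserving and unital. For a linear map $T:M_d\to M_d$ put $$ s_0(T)=\sup_{X\neq 0,\ \operatorname{tr}X=0}\frac{\|T(X)\|_2}{\|X\|_2},\qquad \kappa_{\rm tr}(T)=\sup_{X=X^*\neq 0,\ \operatorname{tr}X=0}\frac{\|T(X)\|_1}{\|X\|_1},\qquad \|T\|_{1\to1}=\sup_{X\ne0}\frac{\|T(X)\|_1}{\|X\|_1}, $$ with $\sup\emptyset=0$, and use $\log 0=-\infty$. Let $(\Omega,\mathcal F,\mathbb P,\theta)$ be an invertible, ergodic, probability-preserving system, and let $\omega\mapsto\Phi_\omega$ be a measurable family of linear maps on $M_d$ that are bistochastic for $\mathbb P$-a.e. $\omega$. For $n\ge1$ set $\Phi_{\omega;n:0}=\Phi_{\theta^{n-1}\omega}\circ\cdots\circ\Phi_{\theta\omega}\circ\Phi_\omega$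 and $\Phi_{\omega;0:-n}=\Phi_{\theta^{-n}\omega;n:0}=\Phi_{\theta^{-1}\omega}\circ\cdots\circ\Phi_{\theta^{-n}\omega}$. Let $R_{\rm unif}(X)=\operatorname{tr}(X)\,I/d$ be the completely depolarizing replacement channel. A dynamically stationary random state is a measurable map $\rho:\Omega\to\mathcal S_d$ with $\Phi_\omega(\rho_\omega)=\rho_{\theta\omega}$ for a.e. $\omega$. **Theorem.** Suppose that $\mathbb E[\log s_0(\Phi_\omega)]<0$, where the expectation of the a.s. nonpositive variable $\log s_0(\Phi_\omega)$ is taken in $[-\infty,0]$. Then: 1. There is a constant $\lambda_{\rm tr}\in[-\infty,0)$ (the trace-Dobrushin Lyapunov exponent) such that $\lim_{n\to\infty}\frac1n\log\kappa_{\rm tr}(\Phi_{\omega;n:0})=\lambda_{\rm tr}$ for a.e. $\omega$, and $$\lambda_{\rm tr}\le\mathbb E[\log s_0(\Phi_\omega)]<0.$$ 2. The cocycle has quenched exponential replacement mixing with the constant state $I/d$. That is, $\rho_\omega=I/d$ is a dynamically stationary random state, and there are a real $\beta<0$ and a finite measurable random variable $C$ such that, for a.e. $\omega$ and every $n\ge1$,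 both $\|\Phi_{\omega;n:0}-R_{\rm unif}\|_{1\to1}$ and $\|\Phi_{\omega;0:-n}-R_{\rm unif}\|_{1\to1}$ are at most $C(\omega)e^{\beta n}$. Moreover, every dynamically stationary random state equals $I/d$ almost surely. 3. For every real $\beta<0$ with $\lambda_{\rm tr}<\beta$ there is a finite measurable random variable $C_\beta$ such that, for a.e. $\omega$ and every $n\ge1$, $$\sup_{\sigma\in\mathcal S_d}\big\|\Phi_{\omega;n:0}(\sigma)-I/d\big\|_1\le C_\beta(\omega)e^{\beta n}\qquad\text{and}\qquad \big\|\Phi_{\omega;n:0}-R_{\rm unif}\big\|_{1\to1}\le C_\beta(\omega)e^{\beta n}.$$ -/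

import Mathlib

open MeasureTheory Filter Topology
open scoped ENNReal Matrix ComplexOrder

namespace BistochasticCocycle

/-- The algebra of complex `d × d` matrices. -/
abbrev Mat (d : ℕ) : Type := Matrix (Fin d) (Fin d) ℂ

/-- Linear maps (superoperators) on `d × d` matrices. -/
abbrev SuperOp (d : ℕ) : Type := Mat d →ₗ[ℂ] Mat d

/-- The density matrices: positive semidefinite matrices of trace one. -/
def states (d : ℕ) : Set (Mat d) := {ρ | ρ.PosSemidef ∧ ρ.trace = 1}

/-- The Hilbert–Schmidt norm `tr(X* X)^{1/2}`. -/
noncomputable def hsNorm {d : ℕ} (X : Mat d) : ℝ := √((Xᴴ * X).trace.re)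

/-- The trace norm (Schatten 1-norm): the sum of the singular values of `X`, that is, of the square
roots of the eigenvalues of `X* X`, counted with multiplicity. -/
noncomputable def traceNorm {d : ℕ} (X : Mat d) : ℝ :=
  ∑ i, √((Matrix.isHermitian_conjTranspose_mul_self X).eigenvalues i)

/-- The ampliation `id ⊗ T` on `M_k ⊗ M_d`: `T` is applied to each of the `k × k` blocks, which are
`d × d` matrices. -/
def ampliation {d : ℕ} (T : SuperOp d) (k : ℕ)
    (M : Matrix (Fin k × Fin d) (Fin k × Fin d) ℂ) :
    Matrix (Fin k × Fin d) (Fin k × Fin d) ℂ :=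
  Matrix.of fun p q => T (Matrix.of fun a b => M (p.1, a) (q.1, b)) p.2 q.2

/-- Complete positivity: every ampliation preserves positive semidefiniteness. -/
def IsCompletelyPositive {d : ℕ} (T : SuperOp d) : Prop :=
  ∀ (k : ℕ) (M : Matrix (Fin k × Fin d) (Fin k × Fin d) ℂ),
    M.PosSemidef → (ampliation T k M).PosSemidef

/-- Bistochastic maps: completely positive, trace preserving and unital. -/
structure IsBistochastic {d : ℕ} (T : SuperOp d) : Prop where
  completelyPositive : IsCompletelyPositive T
  tracePreserving : ∀ X : Mat d, (T X).trace = X.trace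
  unital : T 1 = 1

/-- The trace-zero Hilbert–Schmidt contraction coefficient: the supremum of `‖T X‖₂ / ‖X‖₂` over
the nonzero complex matrices of trace zero (the supremum over the empty set is `0`). -/
noncomputable def hsCoeff {d : ℕ} (T : SuperOp d) : ℝ≥0∞ :=
  ⨆ X ∈ {X : Mat d | X.trace = 0 ∧ X ≠ 0}, ENNReal.ofReal (hsNorm (T X) / hsNorm X)

/-- The centered trace-Dobrushin coefficient: the supremum of `‖T X‖₁ / ‖X‖₁` over the nonzero
self-adjoint matrices of trace zero. -/
noncomputable def dobrushinCoeff {d : ℕ} (T : SuperOp d) : ℝ≥0∞ :=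
  ⨆ X ∈ {X : Mat d | X.IsHermitian ∧ X.trace = 0 ∧ X ≠ 0},
    ENNReal.ofReal (traceNorm (T X) / traceNorm X)

/-- The norm on superoperators induced by the trace norm. -/
noncomputable def oneToOneNorm {d : ℕ} (L : SuperOp d) : ℝ≥0∞ :=
  ⨆ X ∈ {X : Mat d | X ≠ 0}, ENNReal.ofReal (traceNorm (L X) / traceNorm X)

/-- The maximally mixed state `I / d`. -/
noncomputable def maxMixed (d : ℕ) : Mat d := (d : ℂ)⁻¹ • (1 : Mat d)

/-- The replacement map `X ↦ tr(X) η`. -/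
noncomputable def replacement {d : ℕ} (η : Mat d) : SuperOp d :=
  (Matrix.traceLinearMap (Fin d) ℂ ℂ).smulRight η

/-- The forward product `Φ_{θ^{n-1} ω} ∘ ⋯ ∘ Φ_{θ ω} ∘ Φ_ω` (the identity for `n = 0`). -/
def forwardProduct {d : ℕ} {Ω : Type*} (Φ : Ω → SuperOp d) (θ : Ω → Ω) : ℕ → Ω → SuperOp d
  | 0, _ => LinearMap.id
  | n + 1, ω => Φ (θ^[n] ω) ∘ₗ forwardProduct Φ θ n ω

/-- The expectation in `[-∞, 0]` of an extended random variable that is almost surely nonpositive,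
`E[F] = -E[-F]`. -/
noncomputable def nonposExpectation {Ω : Type*} [MeasurableSpace Ω] (P : Measure Ω)
    (F : Ω → EReal) : EReal :=
  -((∫⁻ ω, (-(F ω)).toENNReal ∂P : ℝ≥0∞) : EReal)

/-- A dynamically stationary random state: a measurable map into the density matrices with
`Φ_ω(ρ_ω) = ρ_{θ ω}` almost surely. -/
structure IsStationaryState {d : ℕ} {Ω : Type*} [MeasurableSpace Ω] (P : Measure Ω)
    (Φ : Ω → SuperOp d) (θ : Ω → Ω) (ρ : Ω → Mat d) : Prop where
  measurable : ∀ i j, Measurable fun ω => ρ ω i j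
  mem_states : ∀ ω, ρ ω ∈ states d
  stationary : ∀ᵐ ω ∂P, Φ ω (ρ ω) = ρ (θ ω)

/-- Quenched exponential replacement mixing with the random state `ρ`: the state `ρ` is
dynamically stationary and, almost surely, the forward product over `[0, n]` and the pullback
product over `[-n, 0]` approach the replacement maps onto `ρ_{θ^n ω}` and onto `ρ_ω`, exponentially
fast in the induced trace norm. -/
def QuenchedExponentialReplacement {d : ℕ} {Ω : Type*} [MeasurableSpace Ω] (P : Measure Ω)
    (Φ : Ω → SuperOp d) (θ : Ω ≃ᵐ Ω) (ρ : Ω → Mat d) : Prop :=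
  IsStationaryState P Φ θ ρ ∧
    ∃ β : ℝ, β < 0 ∧ ∃ C : Ω → ℝ, Measurable C ∧ ∀ᵐ ω ∂P, ∀ n : ℕ, 1 ≤ n →
      oneToOneNorm (forwardProduct Φ θ n ω - replacement (ρ (θ^[n] ω))) ≤
        ENNReal.ofReal (C ω * Real.exp (β * n)) ∧
      oneToOneNorm (forwardProduct Φ θ n (θ.symm^[n] ω) - replacement (ρ ω)) ≤
        ENNReal.ofReal (C ω * Real.exp (β * n))

end BistochasticCocycle

/-! Trace preservation keeps the traceless matrices invariant, so both contraction coefficients are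
submultiplicative along the cocycle. Bistochasticity makes both at most 1: the Hilbert–Schmidt bound
is the trace of the Kadison–Schwarz inequality, and the trace-norm bound follows from the Jordan
decomposition of a Hermitian matrix. Hence `negLog` of the Dobrushin coefficient is a superadditive
cocycle with values in `[0, ∞]`. The ergodic theorem `exists_ae_tendsto_superadditive` gives it an
a.s. constant slope `L`, and the exponent is `-L`. No integrability is needed and the value `∞` is
allowed.

The two norms differ by at most a factor `√d`, so the Birkhoff sums of `negLog (hsCoeff (T ω))`
exceed the Dobrushin cocycle by at most `log √d`. Dividing by `n` gives `∫ negLog (hsCoeff (T ω)) ≤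
L`. The same comparison over the inverse system controls the pullback products, since reversing the
order of the factors does not change a sum.

A bistochastic map fixes `I/d`, so its distance from the depolarizing channel is at most a
dimensional constant times its Dobrushin coefficient (`oneToOneNorm_sub_replacement_le`). Eventual
exponential decay of the coefficient thus becomes a bound for all `n` with a random constant.
Uniqueness of the stationary state follows by pulling back: `ρ ω` is the image of a state from the
remote past.

The ergodic theorems rest on the covering inequality `le_add_birkhoffSum_slowSet`: an orbit segment
splits into blocks of slope at least `c`, visits to a set of small measure, and a remainder of
length at most `N`. -/

namespace BistochasticCocycle

/-! ### Pointwise ergodic theorems for superadditive cocycles with values in `[0, ∞]`. -/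

section ErgodicTheory

variable {Ω : Type*} [MeasurableSpace Ω] {P : Measure Ω} {θ : Ω → Ω} {g : ℕ → Ω → ℝ≥0∞}

/-- A superadditive cocycle of `[0, ∞]`-valued functions over `θ`. -/
def IsSuperadditiveCocycle (θ : Ω → Ω) (g : ℕ → Ω → ℝ≥0∞) : Prop :=
  ∀ m n ω, g m ω + g n (θ^[m] ω) ≤ g (m + n) ω

theorem isSuperadditiveCocycle_birkhoffSum {Ω : Type*} (θ : Ω → Ω) (f : Ω → ℝ≥0∞) :
    IsSuperadditiveCocycle θ (birkhoffSum θ f) :=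
  fun m n ω => (birkhoffSum_add θ f m n ω).ge

theorem measurable_birkhoffSum (hθ : Measurable θ) {f : Ω → ℝ≥0∞} (hf : Measurable f) (n : ℕ) :
    Measurable (birkhoffSum θ f n) :=
  Finset.measurable_fun_sum _ fun k _ => hf.comp (hθ.iterate k)

theorem lintegral_birkhoffSum (hθ : MeasurePreserving θ P P) {f : Ω → ℝ≥0∞} (hf : Measurable f)
    (n : ℕ) : ∫⁻ ω, birkhoffSum θ f n ω ∂P = n * ∫⁻ ω, f ω ∂P := by
  simp only [birkhoffSum]
  rw [lintegral_finsetSum _ fun k _ => show Measurable fun ω => f (θ^[k] ω) from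
    hf.comp (hθ.measurable.iterate k)]
  simp [(hθ.iterate _).lintegral_comp hf]

/-- The points at which the cocycle does not reach the slope `c` within `N` steps. -/
def slowSet (g : ℕ → Ω → ℝ≥0∞) (c : ℝ≥0∞) (N : ℕ) : Set Ω :=
  {ω | ∀ n, 1 ≤ n → n ≤ N → g n ω < c * n}

theorem measurableSet_slowSet (hg : ∀ n, Measurable (g n)) (c : ℝ≥0∞) (N : ℕ) :
    MeasurableSet (slowSet g c N) := by
  simp only [slowSet, Set.ofPred_forall]
  exact .iInter fun n => .iInter fun _ => .iInter fun _ =>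
    measurableSet_lt (hg n) measurable_const

/-- The slow sets decrease in `N`, and a point of their intersection never reaches slope `c`;
continuity from above applies because the measure is finite. -/
theorem tendsto_measure_slowSet [IsFiniteMeasure P] (hg : ∀ n, Measurable (g n)) {c : ℝ≥0∞}
    (hc : ∀ᵐ ω ∂P, ∃ n : ℕ, 1 ≤ n ∧ c * n ≤ g n ω) :
    Tendsto (fun N => P (slowSet g c N)) atTop (𝓝 0) := by
  have h0 : P (⋂ N, slowSet g c N) = 0 := by
    refine measure_mono_null ?_ hc
    intro ω hω
    simp only [Set.mem_iInter] at hω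
    simp only [Set.mem_compl_iff, Set.mem_ofPred_eq, not_exists, not_and, not_le]
    exact fun n hn => hω n n hn le_rfl
  rw [← h0]
  refine tendsto_measure_iInter_atTop
    (fun N => (measurableSet_slowSet hg c N).nullMeasurableSet) ?_ ⟨0, measure_ne_top _ _⟩
  exact fun N N' h ω hω n hn hn' => hω n hn (hn'.trans h)

/-- Covering an orbit segment by blocks of slope at least `c` and points of the slow set. -/
theorem le_add_birkhoffSum_slowSet {Ω : Type*} {θ : Ω → Ω} {g : ℕ → Ω → ℝ≥0∞}
    (hsup : IsSuperadditiveCocycle θ g) (c : ℝ≥0∞) (N m : ℕ) :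
    ∀ ω, c * m ≤ g m ω + c * (N + birkhoffSum θ ((slowSet g c N).indicator 1) m ω) := by
  induction m using Nat.strong_induction_on with
  | _ m ih =>
  intro ω
  -- A segment of length at most `N` is absorbed by the error term `c * N`.
  rcases le_or_gt m N with hm | hm
  · have : (m : ℝ≥0∞) ≤ N := by exact_mod_cast hm
    calc c * m ≤ c * (N + birkhoffSum θ ((slowSet g c N).indicator 1) m ω) := by
          gcongr; exact this.trans le_self_add
      _ ≤ _ := le_add_self
  -- From a slow point, advance one step and charge `c` to that visit; from any other point, advance
  -- by a whole block of slope at least `c`.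
  by_cases hω : ω ∈ slowSet g c N
  · obtain ⟨k, rfl⟩ : ∃ k, m = k + 1 := ⟨m - 1, by omega⟩
    rw [birkhoffSum_succ', Set.indicator_of_mem hω]
    have h1 := ih k (by omega) (θ ω)
    have h2 : g k (θ ω) ≤ g (k + 1) ω := by
      have := hsup 1 k ω
      rw [add_comm 1 k] at this
      exact le_add_self.trans this
    calc c * ((k + 1 : ℕ) : ℝ≥0∞) = c * k + c := by push_cast; ring
      _ ≤ g k (θ ω) + c * (N + birkhoffSum θ ((slowSet g c N).indicator 1) k (θ ω)) + c := by
          gcongr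
      _ ≤ g (k + 1) ω + c * (N + birkhoffSum θ ((slowSet g c N).indicator 1) k (θ ω)) + c := by
          gcongr
      _ = _ := by simp only [Pi.one_apply]; ring
  · simp only [slowSet, Set.mem_ofPred_eq, not_forall, not_lt] at hω
    obtain ⟨n, hn, hnN, hcn⟩ := hω
    obtain ⟨k, rfl⟩ : ∃ k, m = n + k := ⟨m - n, by omega⟩
    rw [birkhoffSum_add]
    have h1 := ih k (by omega) (θ^[n] ω)
    calc c * ((n + k : ℕ) : ℝ≥0∞) = c * n + c * k := by push_cast; ring
      _ ≤ g n ω + (g k (θ^[n] ω) +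
            c * (N + birkhoffSum θ ((slowSet g c N).indicator 1) k (θ^[n] ω))) := by gcongr
      _ = (g n ω + g k (θ^[n] ω)) +
            c * (N + birkhoffSum θ ((slowSet g c N).indicator 1) k (θ^[n] ω)) := by ring
      _ ≤ _ := by
          gcongr
          · exact hsup n k ω
          · exact le_add_self

/-- For an ergodic system and two slopes `p < q`, a superadditive cocycle is almost surely
eventually below slope `q`, or almost surely reaches slope `p`. -/
theorem ae_eventually_le_or_ae_exists_ge [IsFiniteMeasure P] (hθ : Ergodic θ P)
    (hg : ∀ n, Measurable (g n)) (hsup : IsSuperadditiveCocycle θ g) {p q : ℝ≥0∞} (hpq : p < q) :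
    (∀ᵐ ω ∂P, ∀ᶠ n : ℕ in atTop, g n ω ≤ q * n) ∨
      ∀ᵐ ω ∂P, ∃ n : ℕ, 1 ≤ n ∧ p * n ≤ g n ω := by
  rcases eq_or_ne q ⊤ with rfl | hq
  · left
    refine .of_forall fun ω => ?_
    filter_upwards [eventually_ge_atTop 1] with n hn
    simp [ENNReal.top_mul (show (n : ℝ≥0∞) ≠ 0 by simp; omega)]
  -- The bounded offset `K` makes this set satisfy `θ ⁻¹' E ⊆ E`: moving back one step costs at most
  -- `q`, which a larger offset absorbs.
  let E : Set Ω := {ω | ∃ K : ℕ, ∃ᶠ n : ℕ in atTop, q * n ≤ g n ω + K}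
  have hE : MeasurableSet E := by
    have : E = ⋃ K : ℕ, ⋂ N : ℕ, ⋃ n : ℕ, ⋃ _ : N ≤ n, {ω | q * n ≤ g n ω + K} := by
      ext ω; simp [E, frequently_atTop]
    rw [this]
    exact .iUnion fun K => .iInter fun N => .iUnion fun n => .iUnion fun _ =>
      measurableSet_le measurable_const ((hg n).add measurable_const)
  have hinv : θ ⁻¹' E ⊆ E := by
    rintro ω ⟨K, hK⟩
    obtain ⟨Q, hQ⟩ := ENNReal.exists_nat_gt hq
    refine ⟨K + Q, ?_⟩
    rw [frequently_atTop] at hK ⊢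
    intro N
    obtain ⟨n, hn, h⟩ := hK N
    refine ⟨n + 1, by omega, ?_⟩
    have h2 : g n (θ ω) ≤ g (n + 1) ω := by
      have := hsup 1 n ω
      rw [add_comm 1 n] at this
      exact le_add_self.trans this
    calc q * ((n + 1 : ℕ) : ℝ≥0∞) = q * n + q := by push_cast; ring
      _ ≤ (g n (θ ω) + K) + Q := by gcongr
      _ ≤ (g (n + 1) ω + K) + Q := by gcongr
      _ = _ := by push_cast; ring
  rcases hθ.ae_empty_or_univ_of_preimage_ae_le hE.nullMeasurableSet
    (Filter.Eventually.of_forall hinv) with h | h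
  · left
    filter_upwards [h.mem_iff] with ω hω
    have : ω ∉ E := by simpa using hω
    simp only [E, Set.mem_ofPred_eq, not_exists, not_frequently, not_le] at this
    filter_upwards [this 0] with n hn
    simpa using hn.le
  · right
    filter_upwards [h.mem_iff] with ω hω
    obtain ⟨K, hK⟩ : ω ∈ E := by simpa using hω
    -- The gap between `p` and `q` eventually outgrows the offset.
    have hev : ∀ᶠ n : ℕ in atTop, p * n + K ≤ q * n := by
      have hqp : q - p ≠ 0 := (tsub_pos_of_lt hpq).ne'
      obtain ⟨M, hM⟩ := ENNReal.exists_nat_gt (ENNReal.div_lt_top (ENNReal.natCast_ne_top K) hqp).ne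
      filter_upwards [eventually_ge_atTop M] with n hn
      have h1 : (K : ℝ≥0∞) ≤ (q - p) * n := by
        rw [mul_comm]
        refine (ENNReal.div_le_iff_le_mul (.inl hqp) (.inl (by simp [hq]))).1 (hM.le.trans ?_)
        exact_mod_cast hn
      calc p * n + K ≤ p * n + (q - p) * n := by gcongr
        _ = q * n := by rw [← add_mul, add_tsub_cancel_of_le hpq.le]
    obtain ⟨n, hn, hn', hn''⟩ := (hK.and_eventually (hev.and (eventually_ge_atTop 1))).exists
    refine ⟨n, hn'', ?_⟩
    exact ENNReal.le_of_add_le_add_right (ENNReal.natCast_ne_top K) (hn'.trans hn)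

/-- Integrating the covering inequality over a segment of length `m` and dividing by `m` gives `c ≤
∫ f + c * P B + c * N / m`, with `B` the slow set. Let `m → ∞`, then `N → ∞`. -/
theorem le_lintegral_of_ae_exists_le_birkhoffSum [IsProbabilityMeasure P]
    (hθ : MeasurePreserving θ P P) {f : Ω → ℝ≥0∞} (hf : Measurable f) {c : ℝ≥0∞} (hc' : c ≠ ⊤)
    (hc : ∀ᵐ ω ∂P, ∃ n : ℕ, 1 ≤ n ∧ c * n ≤ birkhoffSum θ f n ω) : c ≤ ∫⁻ ω, f ω ∂P := by
  have hmeas := measurable_birkhoffSum hθ.measurable hf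
  have key : ∀ N : ℕ, c ≤ ∫⁻ ω, f ω ∂P + c * P (slowSet (birkhoffSum θ f) c N) := by
    intro N
    set B := slowSet (birkhoffSum θ f) c N with hB
    have hBm : MeasurableSet B := measurableSet_slowSet hmeas c N
    have h1 : ∀ m : ℕ, 1 ≤ m → c ≤ (∫⁻ ω, f ω ∂P + c * P B) + c * N / m := by
      intro m hm
      have h := lintegral_mono (μ := P)
        (le_add_birkhoffSum_slowSet (isSuperadditiveCocycle_birkhoffSum θ f) c N m)
      have hi : Measurable (B.indicator (1 : Ω → ℝ≥0∞)) := measurable_one.indicator hBm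
      have hbm := measurable_birkhoffSum hθ.measurable hi m
      rw [lintegral_add_left (hmeas m), lintegral_const_mul _
        (show Measurable fun ω => (N : ℝ≥0∞) + birkhoffSum θ (B.indicator 1) m ω from
          measurable_const.add hbm),
        lintegral_add_left measurable_const, lintegral_birkhoffSum hθ hf,
        lintegral_birkhoffSum hθ hi, lintegral_indicator_one hBm] at h
      simp only [lintegral_const, measure_univ, mul_one] at h
      have hm0 : (m : ℝ≥0∞) ≠ 0 := by simp; omega
      have hm1 : (m : ℝ≥0∞) ≠ ⊤ := ENNReal.natCast_ne_top m
      rw [← ENNReal.mul_le_mul_iff_left hm0 hm1]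
      refine h.trans_eq ?_
      rw [add_mul, ENNReal.div_mul_cancel hm0 hm1]
      ring
    have h2 : Tendsto (fun m : ℕ => (∫⁻ ω, f ω ∂P + c * P B) + c * N / m) atTop
        (𝓝 ((∫⁻ ω, f ω ∂P + c * P B) + 0)) := by
      refine tendsto_const_nhds.add ?_
      exact ENNReal.Tendsto.const_div ENNReal.tendsto_nat_nhds_top
        (.inr (ENNReal.mul_ne_top hc' (ENNReal.natCast_ne_top N))) |>.trans_eq (by simp)
    rw [add_zero] at h2
    exact ge_of_tendsto h2 ((eventually_ge_atTop 1).mono h1)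
  have h2 := ENNReal.Tendsto.const_mul (tendsto_measure_slowSet hmeas hc) (.inr hc')
  have h3 := (tendsto_const_nhds (x := ∫⁻ ω, f ω ∂P)).add h2
  simp only [mul_zero, add_zero] at h3
  exact ge_of_tendsto h3 (.of_forall key)

theorem ae_eventually_birkhoffSum_le [IsProbabilityMeasure P] (hθ : Ergodic θ P)
    {f : Ω → ℝ≥0∞} (hf : Measurable f) {c : ℝ≥0∞} (hc : ∫⁻ ω, f ω ∂P < c) :
    ∀ᵐ ω ∂P, ∀ᶠ n : ℕ in atTop, birkhoffSum θ f n ω ≤ c * n := by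
  obtain ⟨p, hp, hpc⟩ := exists_between hc
  refine (ae_eventually_le_or_ae_exists_ge hθ (measurable_birkhoffSum hθ.measurable hf)
    (isSuperadditiveCocycle_birkhoffSum θ f) hpc).resolve_right fun h => ?_
  exact hp.not_ge (le_lintegral_of_ae_exists_le_birkhoffSum hθ.toMeasurePreserving hf hpc.ne_top h)

/-- For an ergodic system and two slopes `p < q`, a superadditive cocycle is almost surely
eventually below slope `q`, or almost surely eventually above slope `p`. -/
theorem ae_eventually_le_or_ae_eventually_ge [IsProbabilityMeasure P] (hθ : Ergodic θ P)
    (hg : ∀ n, Measurable (g n)) (hsup : IsSuperadditiveCocycle θ g) {p q : ℝ≥0∞} (hpq : p < q) :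
    (∀ᵐ ω ∂P, ∀ᶠ n : ℕ in atTop, g n ω ≤ q * n) ∨
      ∀ᵐ ω ∂P, ∀ᶠ n : ℕ in atTop, p * n ≤ g n ω := by
  obtain ⟨c, hpc, hcq⟩ := exists_between hpq
  have hc := hcq.ne_top
  refine (ae_eventually_le_or_ae_exists_ge hθ hg hsup hcq).imp_right fun h => ?_
  -- A frequency `δ < (c - p) / c` of slow visits costs less than the gap `c - p`, so slope `p`
  -- survives in the covering inequality.
  have hε : (0 : ℝ≥0∞) < (c - p) / c :=
    ENNReal.div_pos (tsub_pos_of_lt hpc).ne' hc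
  obtain ⟨δ, hδ0, hδ⟩ := exists_between hε
  obtain ⟨N, hN⟩ := ((tendsto_measure_slowSet hg h).eventually_lt_const hδ0).exists
  have hBm := measurableSet_slowSet hg c N
  have hi : Measurable ((slowSet g c N).indicator (1 : Ω → ℝ≥0∞)) := measurable_one.indicator hBm
  rw [← lintegral_indicator_one hBm] at hN
  filter_upwards [ae_eventually_birkhoffSum_le hθ hi hN] with ω hω
  have hcδ : c * δ < c - p := by
    have hc0 : c ≠ 0 := (bot_le.trans_lt hpc).ne'
    rw [mul_comm]
    exact (ENNReal.lt_div_iff_mul_lt (.inl hc0) (.inl hc)).1 hδ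
  have hs : c * δ + p < c := by
    have := ENNReal.add_lt_add_right hpc.ne_top hcδ
    rwa [tsub_add_cancel_of_le hpc.le] at this
  have hev : ∀ᶠ n : ℕ in atTop, p * n + c * (N + δ * n) ≤ c * n := by
    have hqp : c - (c * δ + p) ≠ 0 := (tsub_pos_of_lt hs).ne'
    obtain ⟨M, hM⟩ := ENNReal.exists_nat_gt
      (ENNReal.div_lt_top (ENNReal.mul_ne_top hc (ENNReal.natCast_ne_top N)) hqp).ne
    filter_upwards [eventually_ge_atTop M] with n hn
    have h1 : c * N ≤ (c - (c * δ + p)) * n := by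
      rw [mul_comm _ (n : ℝ≥0∞)]
      refine (ENNReal.div_le_iff_le_mul (.inl hqp) (.inl (by simp [hc]))).1 (hM.le.trans ?_)
      exact_mod_cast hn
    calc p * n + c * (N + δ * n) = (c * δ + p) * n + c * N := by ring
      _ ≤ (c * δ + p) * n + (c - (c * δ + p)) * n := by gcongr
      _ = c * n := by rw [← add_mul, add_tsub_cancel_of_le hs.le]
  filter_upwards [hω, hev] with n h1 h2
  have h3 := le_add_birkhoffSum_slowSet hsup c N n ω
  have h4 : p * n + c * (N + δ * n) ≤ g n ω + c * (N + δ * n) := by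
    refine h2.trans (h3.trans ?_)
    gcongr
  refine ENNReal.le_of_add_le_add_right ?_ h4
  exact ENNReal.mul_ne_top hc (ENNReal.add_ne_top.2 ⟨ENNReal.natCast_ne_top N,
    ENNReal.mul_ne_top (hδ.ne_top) (ENNReal.natCast_ne_top n)⟩)

/-- A sequence of extended nonnegative random variables which is, for any two levels, almost surely
eventually below the upper one or almost surely eventually above the lower one, converges almost
surely to a constant. -/
theorem exists_ae_tendsto_const {x : ℕ → Ω → ℝ≥0∞}
    (h : ∀ p q : ℝ≥0∞, p < q → (∀ᵐ ω ∂P, ∀ᶠ n in atTop, x n ω ≤ q) ∨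
      ∀ᵐ ω ∂P, ∀ᶠ n in atTop, p ≤ x n ω) :
    ∃ L : ℝ≥0∞, ∀ᵐ ω ∂P, Tendsto (fun n => x n ω) atTop (𝓝 L) := by
  -- The limit is the infimum of the levels that are a.s. eventual upper bounds. Rational levels
  -- keep the exceptional sets countable in number; below the infimum two of them are needed,
  -- because the dichotomy requires a strict gap.
  let S : Set ℝ≥0∞ := {q | ∀ᵐ ω ∂P, ∀ᶠ n in atTop, x n ω ≤ q}
  refine ⟨sInf S, ?_⟩
  let r : ℚ → ℝ≥0∞ := fun s => ((Real.toNNReal s : NNReal) : ℝ≥0∞)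
  have hlo : ∀ᵐ ω ∂P, ∀ s t : ℚ, r s < r t → r t < sInf S → ∀ᶠ n in atTop, r s ≤ x n ω := by
    refine ae_all_iff.2 fun s => ae_all_iff.2 fun t => ?_
    by_cases hst : r s < r t ∧ r t < sInf S
    · rcases h _ _ hst.1 with h' | h'
      · have hS : r t ∈ S := h'
        exact absurd (sInf_le hS) hst.2.not_ge
      · filter_upwards [h'] with ω hω _ _ using hω
    · exact .of_forall fun ω h1 h2 => absurd ⟨h1, h2⟩ hst
  have hhi : ∀ᵐ ω ∂P, ∀ s : ℚ, sInf S < r s → ∀ᶠ n in atTop, x n ω ≤ r s := by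
    refine ae_all_iff.2 fun s => ?_
    by_cases hs : sInf S < r s
    · obtain ⟨q, hq, hqs⟩ := sInf_lt_iff.1 hs
      have hq' : ∀ᵐ ω ∂P, ∀ᶠ n in atTop, x n ω ≤ q := hq
      filter_upwards [hq'] with ω hω _
      exact hω.mono fun n hn => hn.trans hqs.le
    · exact .of_forall fun ω h1 => absurd h1 hs
  filter_upwards [hlo, hhi] with ω h1 h2
  refine tendsto_order.2 ⟨fun a ha => ?_, fun a ha => ?_⟩
  · obtain ⟨t, -, hat, htS⟩ := ENNReal.lt_iff_exists_rat_btwn.1 ha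
    obtain ⟨s, -, has, hst⟩ := ENNReal.lt_iff_exists_rat_btwn.1 hat
    exact (h1 s t hst htS).mono fun n hn => has.trans_le hn
  · obtain ⟨s, -, hSs, hsa⟩ := ENNReal.lt_iff_exists_rat_btwn.1 ha
    exact (h2 s hSs).mono fun n hn => hn.trans_lt hsa

/-- The **subadditive ergodic theorem** for nonpositive cocycles, in superadditive form. -/
theorem exists_ae_tendsto_superadditive [IsProbabilityMeasure P] (hθ : Ergodic θ P)
    (hg : ∀ n, Measurable (g n)) (hsup : IsSuperadditiveCocycle θ g) :
    ∃ L : ℝ≥0∞, ∀ᵐ ω ∂P, Tendsto (fun n : ℕ => g n ω / n) atTop (𝓝 L) := by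
  refine exists_ae_tendsto_const fun p q hpq => ?_
  refine (ae_eventually_le_or_ae_eventually_ge hθ hg hsup hpq).imp ?_ ?_
  · refine fun h => h.mono fun ω hω => ?_
    filter_upwards [hω, eventually_ge_atTop 1] with n hn hn1
    exact ENNReal.div_le_of_le_mul hn
  · refine fun h => h.mono fun ω hω => ?_
    filter_upwards [hω, eventually_ge_atTop 1] with n hn hn1
    refine (ENNReal.le_div_iff_mul_le (.inl ?_) (.inl (ENNReal.natCast_ne_top n))).2 hn
    simp; omega

/-- The averages converge to a constant by the superadditive theorem; boundedness permits dominated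
convergence, which identifies that constant with the integral. -/
theorem ae_tendsto_birkhoffSum_of_le_const [IsProbabilityMeasure P] (hθ : Ergodic θ P)
    {f : Ω → ℝ≥0∞} (hf : Measurable f) {K : ℝ≥0∞} (hK : K ≠ ⊤) (hfK : ∀ ω, f ω ≤ K) :
    ∀ᵐ ω ∂P, Tendsto (fun n : ℕ => birkhoffSum θ f n ω / n) atTop (𝓝 (∫⁻ ω, f ω ∂P)) := by
  have hm := measurable_birkhoffSum hθ.measurable hf
  obtain ⟨L, hL⟩ := exists_ae_tendsto_superadditive hθ hm (isSuperadditiveCocycle_birkhoffSum θ f)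
  have hb : ∀ n : ℕ, ∀ ω, birkhoffSum θ f n ω / n ≤ K := by
    intro n ω
    refine ENNReal.div_le_of_le_mul ?_
    calc birkhoffSum θ f n ω ≤ ∑ _k ∈ Finset.range n, K := Finset.sum_le_sum fun k _ => hfK _
      _ = K * n := by simp [mul_comm]
  have h := tendsto_lintegral_of_dominated_convergence (fun _ => K)
    (fun n : ℕ => (hm n).div_const (n : ℝ≥0∞)) (fun n => .of_forall (hb n)) (by simp [hK]) hL
  have h' : Tendsto (fun n : ℕ => ∫⁻ ω, birkhoffSum θ f n ω / n ∂P) atTop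
      (𝓝 (∫⁻ ω, f ω ∂P)) := by
    refine tendsto_const_nhds.congr' ?_
    filter_upwards [eventually_ge_atTop 1] with n hn
    have hm0 : (n : ℝ≥0∞) ≠ 0 := by simp; omega
    simp_rw [div_eq_mul_inv]
    rw [lintegral_mul_const _ (hm n), lintegral_birkhoffSum hθ.toMeasurePreserving hf,
      ← div_eq_mul_inv, mul_comm, mul_div_assoc, ENNReal.div_self hm0 (ENNReal.natCast_ne_top n),
      mul_one]
  have hLe : L = ∫⁻ ω, f ω ∂P := by
    have := tendsto_nhds_unique h h'
    simpa using this
  exact hLe ▸ hL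

/-- **Birkhoff's pointwise ergodic theorem**, lower bound, for `[0, ∞]`-valued functions. -/
theorem ae_eventually_lt_birkhoffSum [IsProbabilityMeasure P] (hθ : Ergodic θ P)
    {f : Ω → ℝ≥0∞} (hf : Measurable f) {c : ℝ≥0∞} (hc : c < ∫⁻ ω, f ω ∂P) :
    ∀ᵐ ω ∂P, ∀ᶠ n : ℕ in atTop, c < birkhoffSum θ f n ω / n := by
  -- Truncation at level `K` reduces to the bounded case, which suffices for a lower bound.
  have hmono : ∫⁻ ω, f ω ∂P = ⨆ K : ℕ, ∫⁻ ω, min (f ω) K ∂P := by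
    rw [← lintegral_iSup (fun K => hf.min measurable_const)]
    · refine lintegral_congr fun ω => le_antisymm ?_ (iSup_le fun K => min_le_left _ _)
      refine le_of_forall_lt fun a ha => ?_
      obtain ⟨K, hK⟩ := ENNReal.exists_nat_gt ha.ne_top
      exact (lt_min ha hK).trans_le (le_iSup (fun K : ℕ => min (f ω) (K : ℝ≥0∞)) K)
    · intro K K' h ω
      have : (K : ℝ≥0∞) ≤ K' := by exact_mod_cast h
      exact min_le_min le_rfl this
  rw [hmono] at hc
  obtain ⟨K, hK⟩ := lt_iSup_iff.1 hc
  filter_upwards [ae_tendsto_birkhoffSum_of_le_const hθ (hf.min measurable_const)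
    (ENNReal.natCast_ne_top K) (fun ω => min_le_right _ _)] with ω hω
  filter_upwards [hω.eventually_const_lt hK] with n hn
  refine hn.trans_le ?_
  gcongr
  exact Finset.sum_le_sum fun k _ => min_le_left _ _

end ErgodicTheory

/-! ### Hilbert–Schmidt and trace norms, and Jordan decompositions. -/

section Norms

variable {d : ℕ} {X Y : Mat d}

section Frobenius

open scoped Matrix.Norms.Frobenius

theorem trace_conjTranspose_mul_self_re (X : Mat d) :
    (Xᴴ * X).trace.re = ∑ i, ∑ j, ‖X i j‖ ^ 2 := by
  rw [Finset.sum_comm]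
  simp [Matrix.trace, Matrix.mul_apply, Complex.sq_norm, Complex.normSq_apply]

theorem hsNorm_eq_frobenius_norm (X : Mat d) : hsNorm X = ‖X‖ := by
  rw [hsNorm, trace_conjTranspose_mul_self_re, Matrix.frobenius_norm_def, Real.sqrt_eq_rpow]
  simp

theorem hsNorm_add_le (X Y : Mat d) : hsNorm (X + Y) ≤ hsNorm X + hsNorm Y := by
  simpa only [hsNorm_eq_frobenius_norm] using norm_add_le X Y

theorem hsNorm_smul (c : ℂ) (X : Mat d) : hsNorm (c • X) = ‖c‖ * hsNorm X := by
  simpa only [hsNorm_eq_frobenius_norm] using norm_smul c X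

theorem hsNorm_conjTranspose (X : Mat d) : hsNorm Xᴴ = hsNorm X := by
  simpa only [hsNorm_eq_frobenius_norm] using Matrix.frobenius_norm_conjTranspose X

@[simp]
theorem hsNorm_eq_zero : hsNorm X = 0 ↔ X = 0 := by
  simp only [hsNorm_eq_frobenius_norm, norm_eq_zero]

end Frobenius

theorem hsNorm_nonneg (X : Mat d) : 0 ≤ hsNorm X := Real.sqrt_nonneg _

theorem hsNorm_pos (hX : X ≠ 0) : 0 < hsNorm X :=
  (hsNorm_nonneg X).lt_of_ne' (hsNorm_eq_zero.not.2 hX)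

@[simp]
theorem hsNorm_zero : hsNorm (0 : Mat d) = 0 := hsNorm_eq_zero.2 rfl

theorem hsNorm_sq (X : Mat d) : hsNorm X ^ 2 = ∑ i, ∑ j, ‖X i j‖ ^ 2 := by
  rw [hsNorm, trace_conjTranspose_mul_self_re, Real.sq_sqrt (by positivity)]

theorem continuous_hsNorm : Continuous (hsNorm : Mat d → ℝ) := by
  unfold hsNorm
  fun_prop

theorem eigenvalues_conjTranspose_mul_self_nonneg (X : Mat d) (i : Fin d) :
    0 ≤ (Matrix.isHermitian_conjTranspose_mul_self X).eigenvalues i :=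
  (Matrix.posSemidef_conjTranspose_mul_self X).eigenvalues_nonneg i

theorem hsNorm_eq_sqrt_sum (X : Mat d) :
    hsNorm X = √(∑ i, (Matrix.isHermitian_conjTranspose_mul_self X).eigenvalues i) := by
  rw [hsNorm, (Matrix.isHermitian_conjTranspose_mul_self X).trace_eq_sum_eigenvalues]
  simp

theorem traceNorm_nonneg (X : Mat d) : 0 ≤ traceNorm X :=
  Finset.sum_nonneg fun _ _ => Real.sqrt_nonneg _

theorem hsNorm_le_traceNorm (X : Mat d) : hsNorm X ≤ traceNorm X := by
  rw [hsNorm_eq_sqrt_sum]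
  refine Real.sqrt_le_iff.2 ⟨traceNorm_nonneg X, ?_⟩
  calc _ = ∑ i, √((Matrix.isHermitian_conjTranspose_mul_self X).eigenvalues i) ^ 2 :=
        Finset.sum_congr rfl fun i _ =>
          (Real.sq_sqrt (eigenvalues_conjTranspose_mul_self_nonneg X i)).symm
    _ ≤ _ := Finset.sum_sq_le_sq_sum_of_nonneg fun i _ => Real.sqrt_nonneg _

theorem traceNorm_le_hsNorm (X : Mat d) : traceNorm X ≤ √d * hsNorm X := by
  rw [hsNorm_eq_sqrt_sum, ← Real.sqrt_mul (Nat.cast_nonneg d)]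
  refine Real.le_sqrt_of_sq_le ?_
  have h := sq_sum_le_card_mul_sum_sq (s := (Finset.univ : Finset (Fin d)))
    (f := fun i => √((Matrix.isHermitian_conjTranspose_mul_self X).eigenvalues i))
  simpa [traceNorm, Real.sq_sqrt (eigenvalues_conjTranspose_mul_self_nonneg X _)] using h

theorem traceNorm_pos (hX : X ≠ 0) : 0 < traceNorm X :=
  (hsNorm_pos hX).trans_le (hsNorm_le_traceNorm X)

@[simp]
theorem traceNorm_zero : traceNorm (0 : Mat d) = 0 :=
  le_antisymm ((traceNorm_le_hsNorm 0).trans_eq (by simp)) (traceNorm_nonneg 0)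

/-- Diagonalizing `X` exhibits the characteristic roots of `Xᴴ * X` as the squares `e i ^ 2`;
comparing multisets of roots identifies the singular values with `|e i|` without matching any
indexing. -/
theorem exists_unitary_diagonalization (hX : X.IsHermitian) :
    ∃ (U : Mat d) (e : Fin d → ℝ), Uᴴ * U = 1 ∧ U * Uᴴ = 1 ∧
      X = U * Matrix.diagonal (fun i => (e i : ℂ)) * Uᴴ ∧ traceNorm X = ∑ i, |e i| := by
  let U : Mat d := hX.eigenvectorUnitary
  have hU1 : Uᴴ * U = 1 := Unitary.coe_star_mul_self hX.eigenvectorUnitary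
  have hU2 : U * Uᴴ = 1 := Unitary.coe_mul_star_self hX.eigenvectorUnitary
  let e := hX.eigenvalues
  have hXU : X = U * Matrix.diagonal (fun i => (e i : ℂ)) * Uᴴ := by
    have := hX.spectral_theorem
    rwa [Unitary.conjStarAlgAut_apply] at this
  refine ⟨U, e, hU1, hU2, hXU, ?_⟩
  have hsq : Xᴴ * X = U * Matrix.diagonal (fun i => ((e i ^ 2 : ℝ) : ℂ)) * Uᴴ := by
    rw [hX.eq]
    nth_rw 1 [hXU]
    nth_rw 1 [hXU]
    calc U * Matrix.diagonal (fun i => (e i : ℂ)) * Uᴴ *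
          (U * Matrix.diagonal (fun i => (e i : ℂ)) * Uᴴ)
        = U * Matrix.diagonal (fun i => (e i : ℂ)) * (Uᴴ * U) *
          Matrix.diagonal (fun i => (e i : ℂ)) * Uᴴ := by simp only [Matrix.mul_assoc]
      _ = _ := by
        rw [hU1, Matrix.mul_one, Matrix.mul_assoc U, Matrix.diagonal_mul_diagonal]
        simp [sq]
  have hroots := (Matrix.isHermitian_conjTranspose_mul_self X).roots_charpoly_eq_eigenvalues
  have hchar : (Xᴴ * X).charpoly.roots =
      Multiset.map (fun i => ((e i ^ 2 : ℝ) : ℂ)) Finset.univ.val := by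
    rw [hsq, Matrix.charpoly_mul_comm, ← Matrix.mul_assoc, hU1, Matrix.one_mul,
      Matrix.charpoly_diagonal]
    have := Polynomial.roots_multiset_prod_X_sub_C
      (Multiset.map (fun i => ((e i ^ 2 : ℝ) : ℂ)) Finset.univ.val)
    rwa [Multiset.map_map] at this
  rw [hchar] at hroots
  have h := congrArg (fun s : Multiset ℂ => (s.map fun z => √z.re).sum) hroots
  simp only [Multiset.map_map] at h
  have h2 : ∑ i, √(e i ^ 2) =
      ∑ i, √((Matrix.isHermitian_conjTranspose_mul_self X).eigenvalues i) := by
    simpa [Finset.sum, Function.comp_def, ← Complex.ofReal_pow] using h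
  rw [traceNorm, ← h2]
  simp [Real.sqrt_sq_eq_abs]

/-- In an eigenbasis of `A - B`, each eigenvalue is the difference of two nonnegative diagonal
entries, hence bounded in absolute value by their sum. -/
theorem traceNorm_sub_le_trace_add_trace {A B : Mat d} (hA : A.PosSemidef) (hB : B.PosSemidef) :
    traceNorm (A - B) ≤ A.trace.re + B.trace.re := by
  obtain ⟨U, e, hU1, hU2, hAB, hn⟩ :=
    exists_unitary_diagonalization (hA.isHermitian.sub hB.isHermitian)
  have htr : ∀ C : Mat d, C.trace.re = ∑ i, ((Uᴴ * C * U) i i).re := by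
    intro C
    have : C.trace = (Uᴴ * C * U).trace := by
      rw [Matrix.trace_mul_comm, ← Matrix.mul_assoc, hU2, Matrix.one_mul]
    rw [this, Matrix.trace, Complex.re_sum]
    rfl
  have he : ∀ i, e i = ((Uᴴ * A * U) i i).re - ((Uᴴ * B * U) i i).re := by
    intro i
    have h1 : Uᴴ * A * U - Uᴴ * B * U = Matrix.diagonal (fun i => (e i : ℂ)) := by
      rw [← Matrix.sub_mul, ← Matrix.mul_sub, hAB]
      calc Uᴴ * (U * Matrix.diagonal (fun i => (e i : ℂ)) * Uᴴ) * U
          = (Uᴴ * U) * Matrix.diagonal (fun i => (e i : ℂ)) * (Uᴴ * U) := by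
            simp only [Matrix.mul_assoc]
        _ = _ := by rw [hU1, Matrix.one_mul, Matrix.mul_one]
    have h2 := congrArg (fun M : Mat d => (M i i).re) h1
    simpa using h2.symm
  rw [hn, htr A, htr B, ← Finset.sum_add_distrib]
  refine Finset.sum_le_sum fun i _ => ?_
  have hA' := (Complex.le_def.1 ((hA.conjTranspose_mul_mul_same U).diag_nonneg (i := i))).1
  have hB' := (Complex.le_def.1 ((hB.conjTranspose_mul_mul_same U).diag_nonneg (i := i))).1
  simp only [Complex.zero_re] at hA' hB'
  rw [he i, abs_le]
  constructor <;> linarith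

theorem exists_posSemidef_sub_posSemidef (hX : X.IsHermitian) :
    ∃ A B : Mat d, A.PosSemidef ∧ B.PosSemidef ∧ X = A - B ∧
      A.trace.re + B.trace.re = traceNorm X := by
  obtain ⟨U, e, hU1, hU2, hXU, hn⟩ := exists_unitary_diagonalization hX
  have hpsd : ∀ f : Fin d → ℝ, (∀ i, 0 ≤ f i) →
      (U * Matrix.diagonal (fun i => (f i : ℂ)) * Uᴴ).PosSemidef := fun f hf =>
    (Matrix.PosSemidef.diagonal (d := fun i => (f i : ℂ))
      fun i => by simpa using hf i).mul_mul_conjTranspose_same U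
  have htr : ∀ f : Fin d → ℝ,
      (U * Matrix.diagonal (fun i => (f i : ℂ)) * Uᴴ).trace.re = ∑ i, f i := by
    intro f
    rw [Matrix.trace_mul_comm, ← Matrix.mul_assoc, hU1, Matrix.one_mul, Matrix.trace_diagonal]
    simp
  refine ⟨_, _, hpsd (fun i => (e i)⁺) fun i => posPart_nonneg _,
    hpsd (fun i => (e i)⁻) fun i => negPart_nonneg _, ?_, ?_⟩
  · rw [← Matrix.sub_mul, ← Matrix.mul_sub, Matrix.diagonal_sub]
    simp only [← Complex.ofReal_sub, posPart_sub_negPart]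
    exact hXU
  · rw [htr, htr, hn, ← Finset.sum_add_distrib]
    simp only [posPart_add_negPart]

theorem traceNorm_le_trace (hX : X.PosSemidef) : traceNorm X ≤ X.trace.re := by
  simpa using traceNorm_sub_le_trace_add_trace hX .zero

/-- Add the Jordan decompositions of `X` and `Y`: this writes the sum as a difference of positive
matrices with the right total trace. -/
theorem traceNorm_add_le (hX : X.IsHermitian) (hY : Y.IsHermitian) :
    traceNorm (X + Y) ≤ traceNorm X + traceNorm Y := by
  obtain ⟨A, B, hA, hB, rfl, hn⟩ := exists_posSemidef_sub_posSemidef hX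
  obtain ⟨A', B', hA', hB', rfl, hn'⟩ := exists_posSemidef_sub_posSemidef hY
  have := traceNorm_sub_le_trace_add_trace (hA.add hA') (hB.add hB')
  rw [show A - B + (A' - B') = A + A' - (B + B') by abel]
  simp only [Matrix.trace_add, Complex.add_re] at this
  linarith

/-- The trace norm of the Hermitian part. -/
noncomputable def hermTraceNorm (X : Mat d) : ℝ := traceNorm ((2⁻¹ : ℂ) • (X + Xᴴ))

theorem isHermitian_half_add_conjTranspose (X : Mat d) :
    ((2⁻¹ : ℂ) • (X + Xᴴ)).IsHermitian := by
  rw [Matrix.IsHermitian, Matrix.conjTranspose_smul]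
  simp [add_comm]

theorem hermTraceNorm_eq (hX : X.IsHermitian) : hermTraceNorm X = traceNorm X := by
  rw [hermTraceNorm, hX.eq, ← two_smul ℂ X, smul_smul]
  simp

theorem hermTraceNorm_le (X : Mat d) : hermTraceNorm X ≤ √d * hsNorm X := by
  refine (traceNorm_le_hsNorm _).trans ?_
  gcongr
  rw [hsNorm_smul]
  have := hsNorm_add_le X Xᴴ
  rw [hsNorm_conjTranspose] at this
  norm_num
  linarith

/-- The Hermitian part obeys the trace-norm triangle inequality, so this is a Lipschitz estimate; it
makes `hermTraceNorm` continuous on all matrices. -/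
theorem hermTraceNorm_le_add (X Y : Mat d) :
    hermTraceNorm X ≤ hermTraceNorm Y + √d * hsNorm (X - Y) := by
  have h := traceNorm_add_le (isHermitian_half_add_conjTranspose Y)
    (isHermitian_half_add_conjTranspose (X - Y))
  rw [← smul_add, Matrix.conjTranspose_sub, show Y + Yᴴ + (X - Y + (Xᴴ - Yᴴ)) = X + Xᴴ by abel]
    at h
  have h2 := hermTraceNorm_le (X - Y)
  rw [hermTraceNorm, Matrix.conjTranspose_sub] at h2
  simp only [hermTraceNorm]
  linarith

theorem continuous_hermTraceNorm : Continuous (hermTraceNorm : Mat d → ℝ) := by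
  refine continuous_iff_continuousAt.2 fun Y => ?_
  have h0 : Tendsto (fun X : Mat d => √d * hsNorm (X - Y)) (𝓝 Y) (𝓝 0) := by
    have hc : Continuous fun X : Mat d => √d * hsNorm (X - Y) :=
      continuous_const.mul (continuous_hsNorm.comp (continuous_id.sub continuous_const))
    simpa using hc.tendsto Y
  have h1 := (tendsto_const_nhds (x := hermTraceNorm Y)).sub h0
  have h2 := (tendsto_const_nhds (x := hermTraceNorm Y)).add h0
  rw [sub_zero] at h1
  rw [add_zero] at h2
  refine tendsto_of_tendsto_of_tendsto_of_le_of_le h1 h2 (fun X => ?_)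
    fun X => hermTraceNorm_le_add X Y
  have := hermTraceNorm_le_add Y X
  rw [show Y - X = (-1 : ℂ) • (X - Y) by simp, hsNorm_smul] at this
  simp only [norm_neg, norm_one, one_mul] at this
  simp only
  linarith

end Norms

/-! ### Contractivity of bistochastic maps. -/

section Positivity

variable {d : ℕ} {S T : SuperOp d} {X : Mat d}

theorem IsCompletelyPositive.map_posSemidef (hT : IsCompletelyPositive T) (hX : X.PosSemidef) :
    (T X).PosSemidef := by
  have h := hT 1 (X.submatrix Prod.snd Prod.snd) (hX.submatrix _)
  exact h.submatrix fun a => ((0 : Fin 1), a)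

theorem IsCompletelyPositive.map_isHermitian (hT : IsCompletelyPositive T) (hX : X.IsHermitian) :
    (T X).IsHermitian := by
  obtain ⟨A, B, hA, hB, rfl, -⟩ := exists_posSemidef_sub_posSemidef hX
  rw [map_sub]
  exact (hT.map_posSemidef hA).isHermitian.sub (hT.map_posSemidef hB).isHermitian

/-- The images of the two Jordan parts are again positive and have the same traces. -/
theorem IsBistochastic.traceNorm_map_le (hT : IsBistochastic T) (hX : X.IsHermitian) :
    traceNorm (T X) ≤ traceNorm X := by
  obtain ⟨A, B, hA, hB, rfl, hn⟩ := exists_posSemidef_sub_posSemidef hX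
  rw [← hn, map_sub, ← hT.tracePreserving A, ← hT.tracePreserving B]
  exact traceNorm_sub_le_trace_add_trace (hT.completelyPositive.map_posSemidef hA)
    (hT.completelyPositive.map_posSemidef hB)

/-- The column of blocks with the given entries. -/
def blockColumn {k : ℕ} (Z : Fin k → Mat d) : Matrix (Fin k × Fin d) (Fin d) ℂ :=
  Matrix.of fun p b => Z p.1 p.2 b

theorem blockColumn_conjTranspose_mul_mul {k : ℕ} (Z : Fin k → Mat d)
    (B : Fin k → Fin k → Mat d) :
    (blockColumn Z)ᴴ * (Matrix.of fun p q => B p.1 q.1 p.2 q.2 :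
        Matrix (Fin k × Fin d) (Fin k × Fin d) ℂ) * blockColumn Z =
      ∑ j, ∑ i, (Z i)ᴴ * B i j * Z j := by
  ext a b
  simp only [Matrix.mul_apply, Matrix.sum_apply, Fintype.sum_prod_type, blockColumn,
    Matrix.of_apply, Matrix.conjTranspose_apply, Finset.sum_mul]
  refine Finset.sum_congr rfl fun j _ => ?_
  exact Finset.sum_comm

/-- The **Kadison–Schwarz inequality** for unital completely positive maps. -/
theorem IsCompletelyPositive.kadison_schwarz (hT : IsCompletelyPositive T) (h1 : T 1 = 1)
    (X : Mat d) : (T (Xᴴ * X) - (T X)ᴴ * T X).PosSemidef := by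
  -- The matrix `V Vᴴ` has blocks `XᴴX, Xᴴ; X, 1`. After applying `T` to the blocks, compression by
  -- the column `(1, -T X)` leaves the Schur complement.
  let V : Fin 2 → Mat d := ![Xᴴ, 1]
  have hM : (blockColumn V * (blockColumn V)ᴴ).PosSemidef :=
    Matrix.posSemidef_self_mul_conjTranspose _
  have hB := hT 2 _ hM
  have hblock : ampliation T 2 (blockColumn V * (blockColumn V)ᴴ) =
      Matrix.of fun p q => T (V p.1 * (V q.1)ᴴ) p.2 q.2 := by
    ext p q
    simp only [ampliation, Matrix.of_apply]
    congr 3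
  rw [hblock] at hB
  -- The off-diagonal blocks of a positive, hence Hermitian, matrix are adjoint to each other.
  have hstar : T Xᴴ = (T X)ᴴ := by
    ext a b
    have := hB.isHermitian.apply ((0 : Fin 2), a) ((1 : Fin 2), b)
    simpa [V, Matrix.conjTranspose_apply] using this.symm
  have h := hB.conjTranspose_mul_mul_same (blockColumn ![1, -T X])
  rw [blockColumn_conjTranspose_mul_mul _ fun i j => T (V i * (V j)ᴴ)] at h
  simp only [Fin.sum_univ_two, V, Matrix.cons_val_zero, Matrix.cons_val_one,
    Matrix.conjTranspose_conjTranspose, Matrix.conjTranspose_one, Matrix.one_mul, Matrix.mul_one,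
    h1, hstar, Matrix.conjTranspose_neg, Matrix.neg_mul, Matrix.mul_neg] at h
  convert h using 1
  abel

/-- Take traces in Kadison–Schwarz: unitality gives that inequality, and trace preservation turns
its first term into the trace of `Xᴴ * X`. -/
theorem IsBistochastic.hsNorm_map_le (hT : IsBistochastic T) (X : Mat d) :
    hsNorm (T X) ≤ hsNorm X := by
  refine Real.sqrt_le_sqrt ?_
  have h := (hT.completelyPositive.kadison_schwarz hT.unital X).trace_nonneg
  rw [Matrix.trace_sub, hT.tracePreserving, sub_nonneg] at h
  exact (Complex.le_def.1 h).1

theorem isBistochastic_id : IsBistochastic (LinearMap.id : SuperOp d) where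
  completelyPositive _ _ hM := hM
  tracePreserving _ := rfl
  unital := rfl

theorem IsBistochastic.comp (hS : IsBistochastic S) (hT : IsBistochastic T) :
    IsBistochastic (S ∘ₗ T) where
  completelyPositive k M hM :=
    hS.completelyPositive k _ (hT.completelyPositive k M hM)
  tracePreserving X := (hS.tracePreserving _).trans (hT.tracePreserving X)
  unital := by rw [LinearMap.comp_apply, hT.unital, hS.unital]

end Positivity

/-! ### Contraction coefficients and the distance to the depolarizing channel. -/

section Coefficients

variable {d : ℕ} {S T : SuperOp d} {X : Mat d}

theorem ofReal_hsNorm_map_le (T : SuperOp d) (hX : X.trace = 0) :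
    ENNReal.ofReal (hsNorm (T X)) ≤ hsCoeff T * ENNReal.ofReal (hsNorm X) := by
  rcases eq_or_ne X 0 with rfl | h0
  · simp
  have h : ENNReal.ofReal (hsNorm (T X) / hsNorm X) ≤ hsCoeff T :=
    le_iSup₂_of_le (f := fun X (_ : X ∈ {X : Mat d | X.trace = 0 ∧ X ≠ 0}) =>
      ENNReal.ofReal (hsNorm (T X) / hsNorm X)) X ⟨hX, h0⟩ le_rfl
  calc ENNReal.ofReal (hsNorm (T X))
      = ENNReal.ofReal (hsNorm (T X) / hsNorm X) * ENNReal.ofReal (hsNorm X) := by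
        rw [← ENNReal.ofReal_mul (div_nonneg (hsNorm_nonneg _) (hsNorm_nonneg _)),
          div_mul_cancel₀ _ (hsNorm_pos h0).ne']
    _ ≤ _ := by gcongr

theorem hsCoeff_le {c : ℝ≥0∞} (h : ∀ X : Mat d, X.trace = 0 →
    ENNReal.ofReal (hsNorm (T X)) ≤ c * ENNReal.ofReal (hsNorm X)) : hsCoeff T ≤ c := by
  refine iSup₂_le fun X hX => ?_
  rw [ENNReal.ofReal_div_of_pos (hsNorm_pos hX.2)]
  exact ENNReal.div_le_of_le_mul (h X hX.1)

theorem ofReal_traceNorm_map_le_dobrushinCoeff (T : SuperOp d) (hX : X.IsHermitian)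
    (hX' : X.trace = 0) :
    ENNReal.ofReal (traceNorm (T X)) ≤ dobrushinCoeff T * ENNReal.ofReal (traceNorm X) := by
  rcases eq_or_ne X 0 with rfl | h0
  · simp
  have h : ENNReal.ofReal (traceNorm (T X) / traceNorm X) ≤ dobrushinCoeff T :=
    le_iSup₂_of_le (f := fun X (_ : X ∈ {X : Mat d | X.IsHermitian ∧ X.trace = 0 ∧ X ≠ 0}) =>
      ENNReal.ofReal (traceNorm (T X) / traceNorm X)) X ⟨hX, hX', h0⟩ le_rfl
  calc ENNReal.ofReal (traceNorm (T X))
      = ENNReal.ofReal (traceNorm (T X) / traceNorm X) * ENNReal.ofReal (traceNorm X) := by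
        rw [← ENNReal.ofReal_mul (div_nonneg (traceNorm_nonneg _) (traceNorm_nonneg _)),
          div_mul_cancel₀ _ (traceNorm_pos h0).ne']
    _ ≤ _ := by gcongr

theorem dobrushinCoeff_le {c : ℝ≥0∞} (h : ∀ X : Mat d, X.IsHermitian → X.trace = 0 →
    ENNReal.ofReal (traceNorm (T X)) ≤ c * ENNReal.ofReal (traceNorm X)) :
    dobrushinCoeff T ≤ c := by
  refine iSup₂_le fun X hX => ?_
  rw [ENNReal.ofReal_div_of_pos (traceNorm_pos hX.2.2)]
  exact ENNReal.div_le_of_le_mul (h X hX.1 hX.2.1)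

theorem ofReal_traceNorm_map_le_oneToOneNorm (T : SuperOp d) (X : Mat d) :
    ENNReal.ofReal (traceNorm (T X)) ≤ oneToOneNorm T * ENNReal.ofReal (traceNorm X) := by
  rcases eq_or_ne X 0 with rfl | h0
  · simp
  have h : ENNReal.ofReal (traceNorm (T X) / traceNorm X) ≤ oneToOneNorm T :=
    le_iSup₂_of_le (f := fun X (_ : X ∈ {X : Mat d | X ≠ 0}) =>
      ENNReal.ofReal (traceNorm (T X) / traceNorm X)) X h0 le_rfl
  calc ENNReal.ofReal (traceNorm (T X))
      = ENNReal.ofReal (traceNorm (T X) / traceNorm X) * ENNReal.ofReal (traceNorm X) := by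
        rw [← ENNReal.ofReal_mul (div_nonneg (traceNorm_nonneg _) (traceNorm_nonneg _)),
          div_mul_cancel₀ _ (traceNorm_pos h0).ne']
    _ ≤ _ := by gcongr

theorem IsBistochastic.hsCoeff_le_one (hT : IsBistochastic T) : hsCoeff T ≤ 1 :=
  hsCoeff_le fun X _ => by
    rw [one_mul]
    exact ENNReal.ofReal_le_ofReal (hT.hsNorm_map_le X)

theorem IsBistochastic.dobrushinCoeff_le_one (hT : IsBistochastic T) : dobrushinCoeff T ≤ 1 :=
  dobrushinCoeff_le fun X hX _ => by
    rw [one_mul]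
    exact ENNReal.ofReal_le_ofReal (hT.traceNorm_map_le hX)

theorem hsCoeff_comp_le (S : SuperOp d) (hT : IsBistochastic T) :
    hsCoeff (S ∘ₗ T) ≤ hsCoeff T * hsCoeff S := by
  refine hsCoeff_le fun X hX => ?_
  calc _ ≤ hsCoeff S * ENNReal.ofReal (hsNorm (T X)) :=
        ofReal_hsNorm_map_le S ((hT.tracePreserving X).trans hX)
    _ ≤ hsCoeff S * (hsCoeff T * ENNReal.ofReal (hsNorm X)) := by
        gcongr; exact ofReal_hsNorm_map_le T hX
    _ = _ := by ring

theorem dobrushinCoeff_comp_le (S : SuperOp d) (hT : IsBistochastic T) :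
    dobrushinCoeff (S ∘ₗ T) ≤ dobrushinCoeff T * dobrushinCoeff S := by
  refine dobrushinCoeff_le fun X hX hX' => ?_
  calc _ ≤ dobrushinCoeff S * ENNReal.ofReal (traceNorm (T X)) :=
        ofReal_traceNorm_map_le_dobrushinCoeff S (hT.completelyPositive.map_isHermitian hX)
          ((hT.tracePreserving X).trans hX')
    _ ≤ dobrushinCoeff S * (dobrushinCoeff T * ENNReal.ofReal (traceNorm X)) := by
        gcongr; exact ofReal_traceNorm_map_le_dobrushinCoeff T hX hX'
    _ = _ := by ring

/-- The factor `√d` is lost only once, in the output norm, since `hsNorm` is at most `traceNorm` on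
the input. Applied to a whole product, it costs only a bounded term after taking logarithms. -/
theorem dobrushinCoeff_le_hsCoeff (T : SuperOp d) :
    dobrushinCoeff T ≤ ENNReal.ofReal √d * hsCoeff T := by
  refine dobrushinCoeff_le fun X _ hX' => ?_
  calc _ ≤ ENNReal.ofReal (√d * hsNorm (T X)) := ENNReal.ofReal_le_ofReal (traceNorm_le_hsNorm _)
    _ = ENNReal.ofReal √d * ENNReal.ofReal (hsNorm (T X)) :=
        ENNReal.ofReal_mul (Real.sqrt_nonneg _)
    _ ≤ ENNReal.ofReal √d * (hsCoeff T * ENNReal.ofReal (hsNorm X)) := by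
        gcongr; exact ofReal_hsNorm_map_le T hX'
    _ ≤ ENNReal.ofReal √d * (hsCoeff T * ENNReal.ofReal (traceNorm X)) := by
        gcongr; exact hsNorm_le_traceNorm X
    _ = _ := by ring

theorem trace_half_add_conjTranspose (hX : X.trace = 0) :
    ((2⁻¹ : ℂ) • (X + Xᴴ)).trace = 0 := by
  rw [Matrix.trace_smul, Matrix.trace_add, Matrix.trace_conjTranspose, hX]
  simp

/-- The coefficient sees only Hermitian matrices, so split `X` into its Hermitian and skew-Hermitian
parts. They are recombined in the Hilbert–Schmidt norm, whose triangle inequality holds for all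
matrices; the two parts and two conversions by `√d` produce the constant `2 * d`. -/
theorem IsBistochastic.traceNorm_map_le_of_trace_eq_zero (hT : IsBistochastic T)
    (hX : X.trace = 0) :
    traceNorm (T X) ≤ 2 * d * (dobrushinCoeff T).toReal * hsNorm X := by
  have hκ : dobrushinCoeff T ≠ ⊤ := (hT.dobrushinCoeff_le_one.trans_lt ENNReal.one_lt_top).ne
  have hpart : ∀ Z : Mat d, Z.trace = 0 → hsNorm (T ((2⁻¹ : ℂ) • (Z + Zᴴ))) ≤
      (dobrushinCoeff T).toReal * (√d * hsNorm Z) := by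
    intro Z hZ
    have h := ofReal_traceNorm_map_le_dobrushinCoeff T (isHermitian_half_add_conjTranspose Z)
      (trace_half_add_conjTranspose hZ)
    rw [← ENNReal.ofReal_toReal hκ, ← ENNReal.ofReal_mul ENNReal.toReal_nonneg,
      ENNReal.ofReal_le_ofReal_iff (mul_nonneg ENNReal.toReal_nonneg (traceNorm_nonneg _))] at h
    refine (hsNorm_le_traceNorm _).trans (h.trans ?_)
    gcongr
    exact hermTraceNorm_le Z
  have hdec : X = (2⁻¹ : ℂ) • (X + Xᴴ) +
      Complex.I • ((2⁻¹ : ℂ) • ((-Complex.I) • X + ((-Complex.I) • X)ᴴ)) := by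
    ext i j
    simp only [Matrix.conjTranspose_smul, Matrix.add_apply, Matrix.smul_apply, smul_eq_mul,
      star_neg, Complex.star_def, Complex.conj_I, neg_neg]
    linear_combination (-(1 / 2 : ℂ) * X i j + (1 / 2 : ℂ) * Xᴴ i j) * -Complex.I_mul_I
  have h1 := hpart X hX
  have h2 := hpart ((-Complex.I) • X) (by rw [Matrix.trace_smul, hX, smul_zero])
  rw [hsNorm_smul, norm_neg, Complex.norm_I, one_mul] at h2
  have h3 : hsNorm (T X) ≤ 2 * ((dobrushinCoeff T).toReal * (√d * hsNorm X)) := by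
    conv_lhs => rw [hdec, map_add, map_smul T Complex.I]
    refine (hsNorm_add_le _ _).trans ?_
    rw [hsNorm_smul, Complex.norm_I, one_mul]
    linarith
  calc traceNorm (T X) ≤ √d * hsNorm (T X) := traceNorm_le_hsNorm _
    _ ≤ √d * (2 * ((dobrushinCoeff T).toReal * (√d * hsNorm X))) := by gcongr
    _ = 2 * (√d * √d) * (dobrushinCoeff T).toReal * hsNorm X := by ring
    _ = _ := by rw [Real.mul_self_sqrt (Nat.cast_nonneg d)]

theorem norm_trace_le (X : Mat d) : ‖X.trace‖ ≤ d * hsNorm X := by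
  have h : ∀ i, ‖X i i‖ ≤ hsNorm X := fun i => by
    refine le_of_sq_le_sq ?_ (hsNorm_nonneg X)
    rw [hsNorm_sq]
    calc ‖X i i‖ ^ 2 ≤ ∑ j, ‖X i j‖ ^ 2 :=
          Finset.single_le_sum (f := fun j => ‖X i j‖ ^ 2) (fun j _ => by positivity)
            (Finset.mem_univ i)
      _ ≤ _ := Finset.single_le_sum (f := fun k => ∑ j, ‖X k j‖ ^ 2)
            (fun j _ => by positivity) (Finset.mem_univ i)
  calc ‖X.trace‖ ≤ ∑ i, ‖X i i‖ := norm_sum_le _ _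
    _ ≤ ∑ _i : Fin d, hsNorm X := Finset.sum_le_sum fun i _ => h i
    _ = _ := by simp

theorem trace_maxMixed (hd : 1 ≤ d) : (maxMixed d).trace = 1 := by
  have : (d : ℂ) ≠ 0 := by exact_mod_cast (by omega : d ≠ 0)
  simp [maxMixed, Matrix.trace_smul, this]

theorem maxMixed_mem_states (hd : 1 ≤ d) : maxMixed d ∈ states d :=
  ⟨Matrix.PosSemidef.one.smul (by simp [← Complex.ofReal_natCast, ← Complex.ofReal_inv]),
    trace_maxMixed hd⟩

theorem IsBistochastic.map_maxMixed (hT : IsBistochastic T) : T (maxMixed d) = maxMixed d := by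
  rw [maxMixed, map_smul, hT.unital]

/-- A dimensional constant comparing the distance to the depolarizing channel with the
trace-Dobrushin coefficient. -/
noncomputable def depolarizingConst (d : ℕ) : ℝ := 2 * d * (1 + d * hsNorm (maxMixed d))

theorem depolarizingConst_nonneg (d : ℕ) : 0 ≤ depolarizingConst d := by
  have := hsNorm_nonneg (maxMixed d)
  unfold depolarizingConst
  positivity

theorem IsBistochastic.oneToOneNorm_sub_replacement_le (hd : 1 ≤ d) (hT : IsBistochastic T) :
    oneToOneNorm (T - replacement (maxMixed d)) ≤
      ENNReal.ofReal (depolarizingConst d) * dobrushinCoeff T := by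
  have hκ : dobrushinCoeff T ≠ ⊤ := (hT.dobrushinCoeff_le_one.trans_lt ENNReal.one_lt_top).ne
  refine iSup₂_le fun X (hX : X ≠ 0) => ?_
  have hm := hsNorm_nonneg (maxMixed d)
  rw [← ENNReal.ofReal_toReal hκ, ← ENNReal.ofReal_mul (depolarizingConst_nonneg d)]
  refine ENNReal.ofReal_le_ofReal ((div_le_iff₀ (traceNorm_pos hX)).2 ?_)
  -- Because `T` fixes `I/d`, subtracting the replacement map amounts to centering the input.
  have hmap : (T - replacement (maxMixed d)) X = T (X - X.trace • maxMixed d) := by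
    simp [replacement, hT.map_maxMixed]
  have htr : (X - X.trace • maxMixed d).trace = 0 := by
    simp [Matrix.trace_sub, Matrix.trace_smul, trace_maxMixed hd]
  have hY : hsNorm (X - X.trace • maxMixed d) ≤ (1 + d * hsNorm (maxMixed d)) * hsNorm X := by
    rw [sub_eq_add_neg, ← neg_smul]
    refine (hsNorm_add_le _ _).trans ?_
    rw [hsNorm_smul, norm_neg]
    have := mul_le_mul_of_nonneg_right (norm_trace_le X) hm
    linarith
  rw [hmap]
  calc _ ≤ 2 * d * (dobrushinCoeff T).toReal * hsNorm (X - X.trace • maxMixed d) :=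
        hT.traceNorm_map_le_of_trace_eq_zero htr
    _ ≤ 2 * d * (dobrushinCoeff T).toReal * ((1 + d * hsNorm (maxMixed d)) * traceNorm X) := by
        gcongr
        refine hY.trans ?_
        gcongr
        exact hsNorm_le_traceNorm X
    _ = _ := by unfold depolarizingConst; ring

end Coefficients

/-! ### Measurability of the coefficients and of the random products. -/

section Measurability

variable {d : ℕ} {Ω : Type*} [MeasurableSpace Ω]

theorem Continuous.measurable_comp_matrix {f : Mat d → ℝ} (hf : Continuous f) {Y : Ω → Mat d}
    (hY : ∀ i j, Measurable fun ω => Y ω i j) : Measurable fun ω => f (Y ω) := by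
  let Y' : Ω → Fin d → Fin d → ℂ := Y
  have hY' : Measurable Y' := measurable_pi_iff.2 fun i => measurable_pi_iff.2 fun j => hY i j
  let f' : (Fin d → Fin d → ℂ) → ℝ := f
  have hf' : Continuous f' := hf
  exact hf'.measurable.comp hY'

/-- Continuity on `S` lets a countable dense subset compute the supremum. -/
theorem measurable_biSup_of_continuousOn {S : Set (Mat d)} {F : Ω → Mat d → ℝ≥0∞}
    (hc : ∀ ω, ContinuousOn (F ω) S) (hm : ∀ X ∈ S, Measurable fun ω => F ω X) :
    Measurable fun ω => ⨆ X ∈ S, F ω X := by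
  have : SecondCountableTopology (Mat d) :=
    inferInstanceAs (SecondCountableTopology (Fin d → Fin d → ℂ))
  obtain ⟨D, hDc, hD⟩ := TopologicalSpace.exists_countable_dense S
  have : ∀ ω, ⨆ X ∈ S, F ω X = ⨆ X ∈ D, F ω (X : S) := by
    intro ω
    rw [iSup_subtype']
    refine le_antisymm (iSup_le fun X => ?_)
      (iSup₂_le fun X _ => le_iSup (fun X : S => F ω X) X)
    have hcl : X ∈ closure D := hD X
    have hmem := (hc ω).domRestrict.continuousAt (x := X)
    exact le_of_tendsto_of_frequently hmem ((mem_closure_iff_frequently.1 hcl).mono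
      fun Y hY => le_iSup₂ (f := fun (Y : S) (_ : Y ∈ D) => F ω Y) Y hY)
  simp_rw [this]
  exact .biSup D hDc fun X _ => hm X X.2

variable {T : Ω → SuperOp d}

theorem continuous_superOp (T : SuperOp d) : Continuous T :=
  LinearMap.continuous_of_finiteDimensional T

theorem measurable_hsCoeff (hm : ∀ (X : Mat d) (i j : Fin d), Measurable fun ω => T ω X i j) :
    Measurable fun ω => hsCoeff (T ω) := by
  refine measurable_biSup_of_continuousOn (fun ω => ?_) fun X _ => ?_
  · refine ENNReal.continuous_ofReal.comp_continuousOn (ContinuousOn.div ?_ ?_ ?_)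
    · exact (continuous_hsNorm.comp (continuous_superOp _)).continuousOn
    · exact continuous_hsNorm.continuousOn
    · exact fun X hX => (hsNorm_pos hX.2).ne'
  · exact ((Continuous.measurable_comp_matrix continuous_hsNorm (hm X)).div_const _).ennreal_ofReal

/-- On Hermitian matrices `traceNorm` agrees with the continuous function `hermTraceNorm`;
bistochasticity ensures that the outputs are Hermitian too. -/
theorem measurable_dobrushinCoeff (hT : ∀ ω, IsBistochastic (T ω))
    (hm : ∀ (X : Mat d) (i j : Fin d), Measurable fun ω => T ω X i j) :
    Measurable fun ω => dobrushinCoeff (T ω) := by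
  refine measurable_biSup_of_continuousOn (fun ω => ?_) fun X hX => ?_
  · refine ENNReal.continuous_ofReal.comp_continuousOn (ContinuousOn.div ?_ ?_ ?_)
    · refine (continuous_hermTraceNorm.comp (continuous_superOp (T ω))).continuousOn.congr ?_
      exact fun X hX => (hermTraceNorm_eq ((hT ω).completelyPositive.map_isHermitian hX.1)).symm
    · exact continuous_hermTraceNorm.continuousOn.congr fun X hX => (hermTraceNorm_eq hX.1).symm
    · exact fun X hX => (traceNorm_pos hX.2.2).ne'
  · have h : ∀ ω, traceNorm (T ω X) = hermTraceNorm (T ω X) := fun ω =>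
      (hermTraceNorm_eq ((hT ω).completelyPositive.map_isHermitian hX.1)).symm
    simp_rw [h]
    exact ((Continuous.measurable_comp_matrix continuous_hermTraceNorm
      (hm X)).div_const _).ennreal_ofReal

/-- Here both the map and its argument are random; expanding the argument in matrix units reduces to
fixed arguments. -/
theorem measurable_superOp_apply
    (hm : ∀ (X : Mat d) (i j : Fin d), Measurable fun ω => T ω X i j) {Y : Ω → Mat d}
    (hY : ∀ i j, Measurable fun ω => Y ω i j) (i j : Fin d) :
    Measurable fun ω => T ω (Y ω) i j := by
  have h : ∀ ω, T ω (Y ω) i j = ∑ a, ∑ b, Y ω a b * T ω (Matrix.single a b 1) i j := by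
    intro ω
    conv_lhs => rw [Matrix.matrix_eq_sum_single (Y ω)]
    simp only [map_sum, Matrix.sum_apply]
    refine Finset.sum_congr rfl fun a _ => Finset.sum_congr rfl fun b _ => ?_
    rw [show Matrix.single a b (Y ω a b) = Y ω a b • Matrix.single a b (1 : ℂ) by simp, map_smul]
    rfl
  simp_rw [h]
  exact Finset.measurable_fun_sum _ fun a _ => Finset.measurable_fun_sum _ fun b _ =>
    (hY a b).mul (hm _ i j)

theorem measurable_forwardProduct {θ : Ω → Ω} (hθ : Measurable θ)
    (hm : ∀ (X : Mat d) (i j : Fin d), Measurable fun ω => T ω X i j) (n : ℕ) (X : Mat d) :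
    ∀ i j : Fin d, Measurable fun ω => forwardProduct T θ n ω X i j := by
  induction n with
  | zero => exact fun i j => measurable_const
  | succ n ih =>
    exact measurable_superOp_apply (T := fun ω => T (θ^[n] ω))
      (fun X i j => (hm X i j).comp (hθ.iterate n)) ih

end Measurability

/-! ### Algebra of the forward products. -/

section Cocycle

variable {d : ℕ} {Ω : Type*} {T : Ω → SuperOp d} {θ : Ω → Ω}

theorem isBistochastic_forwardProduct (hT : ∀ ω, IsBistochastic (T ω)) (n : ℕ) (ω : Ω) :
    IsBistochastic (forwardProduct T θ n ω) := by
  induction n with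
  | zero => exact isBistochastic_id
  | succ n ih => exact (hT _).comp ih

theorem forwardProduct_add (m n : ℕ) (ω : Ω) :
    forwardProduct T θ (m + n) ω =
      forwardProduct T θ n (θ^[m] ω) ∘ₗ forwardProduct T θ m ω := by
  induction n with
  | zero => rfl
  | succ n ih =>
    rw [← add_assoc, forwardProduct, ih, forwardProduct, LinearMap.comp_assoc,
      ← Function.iterate_add_apply, add_comm m n]

end Cocycle

/-! ### Negative logarithms in `[0, ∞]`. -/

section NegLog

/-- The positive part of `-log x`, as an extended nonnegative number. -/
noncomputable def negLog (x : ℝ≥0∞) : ℝ≥0∞ := (-(ENNReal.log x)).toENNReal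

theorem measurable_negLog : Measurable negLog :=
  measurable_ereal_toENNReal.comp ENNReal.measurable_log.neg

theorem negLog_anti {x y : ℝ≥0∞} (h : x ≤ y) : negLog y ≤ negLog x :=
  EReal.toENNReal_le_toENNReal (EReal.neg_le_neg_iff.2 (ENNReal.log_le_log h))

theorem log_nonpos_of_le_one {x : ℝ≥0∞} (hx : x ≤ 1) : ENNReal.log x ≤ 0 := by
  simpa using ENNReal.log_le_log hx

theorem log_eq_neg_negLog {x : ℝ≥0∞} (hx : x ≤ 1) : ENNReal.log x = -(negLog x : EReal) := by
  rw [negLog, EReal.coe_toENNReal (EReal.neg_nonneg.2 (log_nonpos_of_le_one hx)), neg_neg]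

theorem coe_ennreal_inv_natCast {n : ℕ} (hn : 1 ≤ n) :
    (((n : ℝ≥0∞)⁻¹ : ℝ≥0∞) : EReal) = (n : EReal)⁻¹ := by
  have hn' : (0 : ℝ) < n := by exact_mod_cast hn
  rw [← ENNReal.ofReal_natCast, ← ENNReal.ofReal_inv_of_pos hn', EReal.coe_ennreal_ofReal,
    max_eq_left (inv_pos.2 hn').le, EReal.coe_inv]
  rfl

theorem log_div_natCast {x : ℝ≥0∞} (hx : x ≤ 1) {n : ℕ} (hn : 1 ≤ n) :
    ENNReal.log x / (n : EReal) = -((negLog x / n : ℝ≥0∞) : EReal) := by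
  rw [log_eq_neg_negLog hx, EReal.div_eq_inv_mul, div_eq_mul_inv, EReal.coe_ennreal_mul,
    coe_ennreal_inv_natCast hn, mul_neg, mul_comm]

theorem negLog_mul {x y : ℝ≥0∞} (hx : x ≤ 1) (hy : y ≤ 1) :
    negLog (x * y) = negLog x + negLog y := by
  have hx' := log_nonpos_of_le_one hx
  have hy' := log_nonpos_of_le_one hy
  rw [negLog, ENNReal.log_mul_add, EReal.neg_add (.inr (hy'.trans_lt EReal.zero_lt_top).ne)
    (.inl (hx'.trans_lt EReal.zero_lt_top).ne), sub_eq_add_neg,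
    EReal.toENNReal_add (EReal.neg_nonneg.2 hx') (EReal.neg_nonneg.2 hy')]
  rfl

theorem le_exp_neg_of_le_negLog {x : ℝ≥0∞} (hx : x ≤ 1) {y : ℝ}
    (h : ENNReal.ofReal y ≤ negLog x) : x ≤ ENNReal.ofReal (Real.exp (-y)) := by
  refine ENNReal.log_strictMono.le_iff_le.1 ?_
  rw [log_eq_neg_negLog hx, ENNReal.log_ofReal, if_neg (Real.exp_pos _).not_ge, Real.log_exp,
    EReal.coe_neg, EReal.neg_le_neg_iff]
  calc (y : EReal) ≤ ((ENNReal.ofReal y : ℝ≥0∞) : EReal) := by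
        rw [EReal.coe_ennreal_ofReal]; exact_mod_cast le_max_left _ _
    _ ≤ _ := by exact_mod_cast h

/-- Multiplication by `c` shifts the logarithm by `log c`, and passing to the positive part is
subadditive. -/
theorem negLog_le_negLog_mul_add {c : ℝ} (hc : 0 < c) (x : ℝ≥0∞) :
    negLog x ≤ negLog (ENNReal.ofReal c * x) + ENNReal.ofReal (Real.log c) := by
  have h : -ENNReal.log x = -ENNReal.log (ENNReal.ofReal c * x) + (Real.log c : EReal) := by
    rw [ENNReal.log_mul_add, ENNReal.log_ofReal, if_neg hc.not_ge,
      EReal.neg_add (.inl (EReal.coe_ne_bot _)) (.inl (EReal.coe_ne_top _))]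
    induction ENNReal.log x with
    | bot => simp [sub_eq_add_neg, ← EReal.coe_neg]
    | top => simp
    | coe a => norm_cast; ring
  rw [negLog, h]
  exact EReal.toENNReal_add_le

end NegLog

/-! ### From eventual exponential decay to a random constant. -/

section RandomBounds

variable {Ω : Type*} [MeasurableSpace Ω] {P : Measure Ω}

theorem exists_measurable_exponential_bound {a : ℕ → Ω → ℝ≥0∞} (ha : ∀ n, Measurable (a n))
    (hfin : ∀ n ω, a n ω ≠ ⊤) {β : ℝ}
    (h : ∀ᵐ ω ∂P, ∀ᶠ n : ℕ in atTop, a n ω ≤ ENNReal.ofReal (Real.exp (β * n))) :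
    ∃ C : Ω → ℝ, Measurable C ∧ (∀ ω, 0 ≤ C ω) ∧
      ∀ᵐ ω ∂P, ∀ n : ℕ, a n ω ≤ ENNReal.ofReal (C ω * Real.exp (β * n)) := by
  -- The optimal constant is a countable supremum, hence measurable. It is a.s. finite because the
  -- tail terms are at most 1 and the finitely many others are finite.
  let s : Ω → ℝ≥0∞ := fun ω => ⨆ n : ℕ, a n ω * ENNReal.ofReal (Real.exp (-(β * n)))
  have hs : Measurable s := .iSup fun n => (ha n).mul_const _
  have hexp : ∀ x : ℝ, ENNReal.ofReal (Real.exp (-x)) * ENNReal.ofReal (Real.exp x) = 1 := by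
    intro x
    rw [← ENNReal.ofReal_mul (Real.exp_pos _).le, ← Real.exp_add]
    simp
  refine ⟨fun ω => (s ω).toReal, hs.ennreal_toReal, fun ω => ENNReal.toReal_nonneg, ?_⟩
  filter_upwards [h] with ω hω
  obtain ⟨N, hN⟩ := eventually_atTop.1 hω
  have hsfin : s ω ≠ ⊤ := by
    have hterm : ∀ n : ℕ, a n ω * ENNReal.ofReal (Real.exp (-(β * n))) ≠ ⊤ := fun n =>
      ENNReal.mul_ne_top (hfin n ω) ENNReal.ofReal_ne_top
    have hb : s ω ≤ 1 + ∑ n ∈ Finset.range N, a n ω * ENNReal.ofReal (Real.exp (-(β * n))) := by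
      refine iSup_le fun n => ?_
      rcases le_or_gt N n with hn | hn
      · refine le_trans ?_ le_self_add
        calc _ ≤ ENNReal.ofReal (Real.exp (β * n)) * ENNReal.ofReal (Real.exp (-(β * n))) := by
              gcongr; exact hN n hn
          _ = 1 := by rw [mul_comm, hexp]
      · refine le_trans ?_ le_add_self
        exact Finset.single_le_sum
          (f := fun n : ℕ => a n ω * ENNReal.ofReal (Real.exp (-(β * n))))
          (fun _ _ => zero_le) (Finset.mem_range.2 hn)
    refine (hb.trans_lt ?_).ne
    exact ENNReal.add_lt_top.2 ⟨ENNReal.one_lt_top,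
      ENNReal.sum_lt_top.2 fun n _ => (hterm n).lt_top⟩
  intro n
  rw [ENNReal.ofReal_mul ENNReal.toReal_nonneg, ENNReal.ofReal_toReal hsfin]
  calc a n ω = a n ω * ENNReal.ofReal (Real.exp (-(β * n))) *
        ENNReal.ofReal (Real.exp (β * n)) := by rw [mul_assoc, hexp, mul_one]
    _ ≤ _ := by
      gcongr
      exact le_iSup (fun n : ℕ => a n ω * ENNReal.ofReal (Real.exp (-(β * n)))) n

theorem eventually_le_exp_of_eventually_lt_negLog_div {x : ℕ → ℝ≥0∞} (hx : ∀ n, x n ≤ 1) {b : ℝ}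
    (h : ∀ᶠ n : ℕ in atTop, ENNReal.ofReal b < negLog (x n) / n) :
    ∀ᶠ n : ℕ in atTop, x n ≤ ENNReal.ofReal (Real.exp (-b * n)) := by
  filter_upwards [h] with n hn
  rw [neg_mul]
  refine le_exp_neg_of_le_negLog (hx n) ?_
  rw [ENNReal.ofReal_mul' (Nat.cast_nonneg n), ENNReal.ofReal_natCast]
  exact ENNReal.mul_le_of_le_div hn.le

end RandomBounds

/-! ### Comparison of the Dobrushin exponent with the expectation of `log s₀`. -/

section Exponents

variable {d : ℕ} {Ω : Type*} {T : Ω → SuperOp d} {θ : Ω → Ω}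

theorem isSuperadditiveCocycle_negLog_dobrushinCoeff (hT : ∀ ω, IsBistochastic (T ω)) :
    IsSuperadditiveCocycle θ fun n ω => negLog (dobrushinCoeff (forwardProduct T θ n ω)) := by
  intro m n ω
  simp only
  have hb := isBistochastic_forwardProduct (θ := θ) hT
  rw [← negLog_mul (hb m ω).dobrushinCoeff_le_one (hb n _).dobrushinCoeff_le_one,
    forwardProduct_add]
  exact negLog_anti (dobrushinCoeff_comp_le _ (hb m ω))

theorem birkhoffSum_negLog_hsCoeff_le (hT : ∀ ω, IsBistochastic (T ω)) (n : ℕ) (ω : Ω) :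
    birkhoffSum θ (fun ω => negLog (hsCoeff (T ω))) n ω ≤
      negLog (hsCoeff (forwardProduct T θ n ω)) := by
  have hb := isBistochastic_forwardProduct (θ := θ) hT
  induction n with
  | zero => simp
  | succ n ih =>
    rw [birkhoffSum_succ]
    refine (add_le_add_left ih _).trans ?_
    rw [← negLog_mul (hb n ω).hsCoeff_le_one (hT _).hsCoeff_le_one]
    exact negLog_anti (hsCoeff_comp_le _ (hb n ω))

theorem birkhoffSum_negLog_hsCoeff_le_dobrushin (hd : 1 ≤ d) (hT : ∀ ω, IsBistochastic (T ω))
    (n : ℕ) (ω : Ω) :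
    birkhoffSum θ (fun ω => negLog (hsCoeff (T ω))) n ω ≤
      negLog (dobrushinCoeff (forwardProduct T θ n ω)) + ENNReal.ofReal (Real.log √d) := by
  have hd' : (0 : ℝ) < d := by exact_mod_cast hd
  refine (birkhoffSum_negLog_hsCoeff_le hT n ω).trans
    ((negLog_le_negLog_mul_add (Real.sqrt_pos.2 hd') _).trans ?_)
  gcongr
  exact negLog_anti (dobrushinCoeff_le_hsCoeff _)

theorem tendsto_const_div_natCast_zero {c : ℝ≥0∞} (hc : c ≠ ⊤) :
    Tendsto (fun n : ℕ => c / n) atTop (𝓝 0) := by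
  simpa using ENNReal.Tendsto.const_div ENNReal.tendsto_nat_nhds_top (.inr hc)

theorem eventually_lt_of_eventually_lt_add_div {u : ℕ → ℝ≥0∞} {b b' c : ℝ≥0∞} (hc : c ≠ ⊤)
    (hb : b < b') (h : ∀ᶠ n : ℕ in atTop, b' < (u n + c) / n) :
    ∀ᶠ n : ℕ in atTop, b < u n / n := by
  filter_upwards [h, (tendsto_const_div_natCast_zero hc).eventually_lt_const
    (tsub_pos_of_lt hb)] with n h1 h2
  rw [ENNReal.add_div] at h1
  by_contra! h3
  have := h1.trans_le (add_le_add h3 h2.le)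
  rw [add_tsub_cancel_of_le hb.le] at this
  exact this.false

/-- Both sides sum `f` over the past points from `e⁻ⁿ ω` to `e⁻¹ ω`, in opposite orders; this turns
pullback products into Birkhoff sums over the inverse system. -/
theorem birkhoffSum_symm_iterate {M : Type*} [AddCommMonoid M] (e : Ω ≃ Ω) (f : Ω → M) (n : ℕ)
    (ω : Ω) : birkhoffSum e f n (e.symm^[n] ω) = birkhoffSum e.symm (f ∘ e.symm) n ω := by
  induction n with
  | zero => simp
  | succ n ih =>
    rw [birkhoffSum_succ', Function.iterate_succ_apply', e.apply_symm_apply, ih, birkhoffSum_succ,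
      add_comm, Function.comp_apply]

variable [MeasurableSpace Ω] {P : Measure Ω} [IsProbabilityMeasure P]

/-- Birkhoff's lower bound holds for every level below the integral, and the additive `log √d`
disappears after division by `n`. Both limits being constants, a single good `ω` suffices. -/
theorem lintegral_negLog_hsCoeff_le_exponent (hd : 1 ≤ d) (hθ : Ergodic θ P)
    (hT : ∀ ω, IsBistochastic (T ω))
    (hm : ∀ (X : Mat d) (i j : Fin d), Measurable fun ω => T ω X i j) {L : ℝ≥0∞}
    (hL : ∀ᵐ ω ∂P, Tendsto
      (fun n : ℕ => negLog (dobrushinCoeff (forwardProduct T θ n ω)) / n) atTop (𝓝 L)) :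
    ∫⁻ ω, negLog (hsCoeff (T ω)) ∂P ≤ L := by
  refine le_of_forall_lt fun c hc => ?_
  obtain ⟨c', hcc', hc'⟩ := exists_between hc
  have hbk := ae_eventually_lt_birkhoffSum hθ (measurable_negLog.comp (measurable_hsCoeff hm)) hc'
  obtain ⟨c'', hcc'', hc''⟩ := exists_between hcc'
  obtain ⟨ω, h1, h2⟩ := (hL.and hbk).exists
  refine hcc''.trans_le (ge_of_tendsto h1 ?_)
  refine (eventually_lt_of_eventually_lt_add_div (c := ENNReal.ofReal (Real.log √d))
    ENNReal.ofReal_ne_top hc'' (h2.mono fun n hn => hn.trans_le ?_)).mono fun n hn => hn.le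
  gcongr
  exact birkhoffSum_negLog_hsCoeff_le_dobrushin hd hT n ω

/-- Birkhoff's lower bound for `θ.symm` is applied to `f ∘ θ.symm`, which has the same integral as
`f`. The pullback rate is thus any `b` below that integral, rather than below the exponent `L`. -/
theorem ae_eventually_dobrushinCoeff_backward_le (hd : 1 ≤ d) {θ : Ω ≃ᵐ Ω} (hθ : Ergodic θ P)
    (hT : ∀ ω, IsBistochastic (T ω))
    (hm : ∀ (X : Mat d) (i j : Fin d), Measurable fun ω => T ω X i j) {b : ℝ}
    (hb : ENNReal.ofReal b < ∫⁻ ω, negLog (hsCoeff (T ω)) ∂P) :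
    ∀ᵐ ω ∂P, ∀ᶠ n : ℕ in atTop, dobrushinCoeff (forwardProduct T θ n (θ.symm^[n] ω)) ≤
      ENNReal.ofReal (Real.exp (-b * n)) := by
  obtain ⟨c, hbc, hc⟩ := exists_between hb
  have hf : Measurable fun ω => negLog (hsCoeff (T ω)) :=
    measurable_negLog.comp (measurable_hsCoeff hm)
  have hint := hθ.symm.toMeasurePreserving.lintegral_comp hf
  rw [← hint] at hc
  filter_upwards [ae_eventually_lt_birkhoffSum hθ.symm (hf.comp θ.symm.measurable) hc] with ω hω
  refine eventually_le_exp_of_eventually_lt_negLog_div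
    (fun n => (isBistochastic_forwardProduct hT n _).dobrushinCoeff_le_one) ?_
  refine eventually_lt_of_eventually_lt_add_div (c := ENNReal.ofReal (Real.log √d))
    ENNReal.ofReal_ne_top hbc (hω.mono fun n hn => hn.trans_le ?_)
  gcongr
  have h := birkhoffSum_symm_iterate θ.toEquiv (fun ω => negLog (hsCoeff (T ω))) n ω
  exact h.symm.trans_le (birkhoffSum_negLog_hsCoeff_le_dobrushin hd hT n _)

end Exponents

/-! ### Bounds on states and on the distance to the replacement map. -/

section Replacement

variable {d : ℕ} {T : SuperOp d}

theorem sub_replacement_apply (T : SuperOp d) {σ : Mat d} (hσ : σ ∈ states d) :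
    (T - replacement (maxMixed d)) σ = T σ - maxMixed d := by
  simp [replacement, hσ.2]

theorem traceNorm_map_state_sub_le {σ : Mat d} (hσ : σ ∈ states d) {c : ℝ} (hc : 0 ≤ c)
    (h : oneToOneNorm (T - replacement (maxMixed d)) ≤ ENNReal.ofReal c) :
    traceNorm (T σ - maxMixed d) ≤ c := by
  rw [← sub_replacement_apply T hσ, ← ENNReal.ofReal_le_ofReal_iff hc]
  refine (ofReal_traceNorm_map_le_oneToOneNorm _ σ).trans ?_
  have h1 : ENNReal.ofReal (traceNorm σ) ≤ 1 := by
    rw [← ENNReal.ofReal_one]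
    refine ENNReal.ofReal_le_ofReal ((traceNorm_le_trace hσ.1).trans ?_)
    simp [hσ.2]
  calc _ ≤ ENNReal.ofReal c * 1 := mul_le_mul' h h1
    _ = _ := mul_one _

theorem IsBistochastic.oneToOneNorm_sub_replacement_le_ofReal (hd : 1 ≤ d)
    (hT : IsBistochastic T) {c e : ℝ} (h : dobrushinCoeff T ≤ ENNReal.ofReal (c * e)) :
    oneToOneNorm (T - replacement (maxMixed d)) ≤
      ENNReal.ofReal (depolarizingConst d * c * e) := by
  rw [mul_assoc, ENNReal.ofReal_mul (depolarizingConst_nonneg d)]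
  refine (hT.oneToOneNorm_sub_replacement_le hd).trans ?_
  gcongr

end Replacement

/-! ### Uniqueness of the stationary state and an everywhere bistochastic version. -/

section StationaryStates

variable {d : ℕ} {Ω : Type*} [MeasurableSpace Ω] {P : Measure Ω} {Φ : Ω → SuperOp d} {θ : Ω ≃ᵐ Ω}

theorem ae_forall_iterate {f : Ω → Ω} (hf : MeasurePreserving f P P) {p : Ω → Prop}
    (h : ∀ᵐ ω ∂P, p ω) : ∀ᵐ ω ∂P, ∀ n, p (f^[n] ω) :=
  ae_all_iff.2 fun n => (hf.iterate n).quasiMeasurePreserving.ae h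

theorem IsStationaryState.forwardProduct_apply {ρ : Ω → Mat d} {ω : Ω}
    (h : ∀ k, Φ (θ^[k] ω) (ρ (θ^[k] ω)) = ρ (θ (θ^[k] ω))) (n : ℕ) :
    forwardProduct Φ θ n ω (ρ ω) = ρ (θ^[n] ω) := by
  induction n with
  | zero => rfl
  | succ n ih =>
    rw [forwardProduct, LinearMap.comp_apply, ih, h, Function.iterate_succ_apply']

/-- Quenched exponential replacement mixing onto `I / d` determines the stationary state. -/
theorem QuenchedExponentialReplacement.ae_eq_maxMixed (hθ : MeasurePreserving θ P P)
    (h : QuenchedExponentialReplacement P Φ θ fun _ => maxMixed d) {ρ : Ω → Mat d}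
    (hρ : IsStationaryState P Φ θ ρ) : ∀ᵐ ω ∂P, ρ ω = maxMixed d := by
  obtain ⟨-, β, hβ, C, -, hC⟩ := h
  -- Stationarity is needed along the forward orbit of every past point `θ⁻ⁿ ω`, so that `ρ ω` is
  -- the pullback product applied to the state there.
  have h1 := ae_forall_iterate (hθ.symm θ) (ae_forall_iterate hθ hρ.stationary)
  filter_upwards [hC, h1] with ω hω h1ω
  have hinv : ∀ n, θ^[n] (θ.symm^[n] ω) = ω := fun n =>
    (Function.LeftInverse.iterate θ.apply_symm_apply n) ω
  -- The maximum with 0 is taken because the mixing property does not fix the sign of `C`.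
  have hle : ∀ n : ℕ, 1 ≤ n → traceNorm (ρ ω - maxMixed d) ≤ max (C ω) 0 * Real.exp (β * n) := by
    intro n hn
    have h2 := IsStationaryState.forwardProduct_apply (h1ω n) n
    rw [hinv] at h2
    rw [← h2]
    refine traceNorm_map_state_sub_le (hρ.mem_states _) (by positivity) ((hω n hn).2.trans ?_)
    gcongr
    exact le_max_left _ _
  have hlim : Tendsto (fun n : ℕ => max (C ω) 0 * Real.exp (β * n)) atTop (𝓝 0) := by
    have := (Real.tendsto_exp_atBot.comp
      (tendsto_natCast_atTop_atTop.const_mul_atTop_of_neg hβ)).const_mul (max (C ω) 0)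
    simpa using this
  have h0 := ge_of_tendsto hlim ((eventually_ge_atTop 1).mono hle)
  by_contra hne
  exact h0.not_gt (traceNorm_pos (sub_ne_zero.2 hne))

theorem forwardProduct_congr {Φ Ψ : Ω → SuperOp d} {ω : Ω} (h : ∀ k, Ψ (θ^[k] ω) = Φ (θ^[k] ω))
    (n : ℕ) : forwardProduct Ψ θ n ω = forwardProduct Φ θ n ω := by
  induction n with
  | zero => rfl
  | succ n ih => rw [forwardProduct, forwardProduct, ih, h]

/-- A measurable family of maps that are almost surely bistochastic has a measurable version that is
bistochastic everywhere. -/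
theorem exists_bistochastic_version
    (hm : ∀ (X : Mat d) (i j : Fin d), Measurable fun ω => Φ ω X i j)
    (hΦ : ∀ᵐ ω ∂P, IsBistochastic (Φ ω)) :
    ∃ Ψ : Ω → SuperOp d, (∀ ω, IsBistochastic (Ψ ω)) ∧
      (∀ (X : Mat d) (i j : Fin d), Measurable fun ω => Ψ ω X i j) ∧ ∀ᵐ ω ∂P, Ψ ω = Φ ω := by
  classical
  -- A measurable null set covering the exceptional points; on it the map is replaced by the
  -- identity.
  let N := toMeasurable P {ω | ¬ IsBistochastic (Φ ω)}
  have hN : MeasurableSet N := measurableSet_toMeasurable _ _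
  have hN0 : P N = 0 := (measure_toMeasurable _).trans hΦ
  refine ⟨fun ω => if ω ∈ N then LinearMap.id else Φ ω, fun ω => ?_, fun X i j => ?_, ?_⟩
  · by_cases hω : ω ∈ N
    · simp only [if_pos hω]
      exact isBistochastic_id
    · simp only [if_neg hω]
      by_contra hcon
      exact hω (subset_toMeasurable P _ hcon)
  · have : (fun ω => (if ω ∈ N then LinearMap.id else Φ ω : SuperOp d) X i j) =
        fun ω => if ω ∈ N then X i j else Φ ω X i j := by
      funext ω
      split_ifs <;> rfl
    rw [this]
    exact Measurable.ite hN measurable_const (hm X i j)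
  · have : ∀ᵐ ω ∂P, ω ∉ N := measure_eq_zero_iff_ae_notMem.1 hN0
    filter_upwards [this] with ω hω
    simp only [if_neg hω]

end StationaryStates

end BistochasticCocycle

/-! ### The main theorem. -/

theorem mainTheorem12 {Ω : Type*} [MeasurableSpace Ω] (P : Measure Ω) [IsProbabilityMeasure P]
    (θ : Ω ≃ᵐ Ω) (hθ : Ergodic θ P) (d : ℕ) (hd : 1 ≤ d)
    (Φ : Ω → BistochasticCocycle.SuperOp d)
    (hmeas : ∀ (X : BistochasticCocycle.Mat d) (i j : Fin d), Measurable fun ω => Φ ω X i j)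
    (hbi : ∀ᵐ ω ∂P, BistochasticCocycle.IsBistochastic (Φ ω))
    (hneg : BistochasticCocycle.nonposExpectation P
      (fun ω => ENNReal.log (BistochasticCocycle.hsCoeff (Φ ω))) < 0) :
    ∃ lam : EReal,
      -- `lam` is the trace-Dobrushin Lyapunov exponent
      (∀ᵐ ω ∂P, Tendsto
        (fun n : ℕ => ENNReal.log (BistochasticCocycle.dobrushinCoeff
          (BistochasticCocycle.forwardProduct Φ θ n ω)) / (n : EReal)) atTop (𝓝 lam)) ∧
      lam ≤ BistochasticCocycle.nonposExpectation P
        (fun ω => ENNReal.log (BistochasticCocycle.hsCoeff (Φ ω))) ∧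
      lam < 0 ∧
      BistochasticCocycle.QuenchedExponentialReplacement P Φ θ
        (fun _ => BistochasticCocycle.maxMixed d) ∧
      (∀ ρ : Ω → BistochasticCocycle.Mat d, BistochasticCocycle.IsStationaryState P Φ θ ρ →
        ∀ᵐ ω ∂P, ρ ω = BistochasticCocycle.maxMixed d) ∧
      ∀ β : ℝ, β < 0 → lam < (β : EReal) →
        ∃ C : Ω → ℝ, Measurable C ∧ ∀ᵐ ω ∂P, ∀ n : ℕ, 1 ≤ n →
          (∀ σ ∈ BistochasticCocycle.states d,
            BistochasticCocycle.traceNorm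
              (BistochasticCocycle.forwardProduct Φ θ n ω σ - BistochasticCocycle.maxMixed d) ≤
              C ω * Real.exp (β * n)) ∧
          BistochasticCocycle.oneToOneNorm
            (BistochasticCocycle.forwardProduct Φ θ n ω -
              BistochasticCocycle.replacement (BistochasticCocycle.maxMixed d)) ≤
            ENNReal.ofReal (C ω * Real.exp (β * n)) := by
  -- The bistochastic version makes superadditivity and the bounds by 1 hold at every point. Its
  -- forward and pullback products agree a.s. with the original ones for all `n` at once.
  obtain ⟨Ψ, hΨ, hΨm, hΨΦ⟩ := BistochasticCocycle.exists_bistochastic_version hmeas hbi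
  have hθm := hθ.toMeasurePreserving
  have hfwd : ∀ᵐ ω ∂P, ∀ n, BistochasticCocycle.forwardProduct Ψ θ n ω =
      BistochasticCocycle.forwardProduct Φ θ n ω := by
    filter_upwards [BistochasticCocycle.ae_forall_iterate hθm hΨΦ] with ω hω n
    exact BistochasticCocycle.forwardProduct_congr hω n
  have hbwd : ∀ᵐ ω ∂P, ∀ n, BistochasticCocycle.forwardProduct Ψ θ n (θ.symm^[n] ω) =
      BistochasticCocycle.forwardProduct Φ θ n (θ.symm^[n] ω) := by
    filter_upwards [BistochasticCocycle.ae_forall_iterate (hθm.symm θ) hfwd] with ω hω n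
    exact hω n n
  have hΨn := BistochasticCocycle.isBistochastic_forwardProduct (θ := θ) hΨ
  have hκm : ∀ n, Measurable fun ω => BistochasticCocycle.dobrushinCoeff
      (BistochasticCocycle.forwardProduct Ψ θ n ω) := fun n =>
    BistochasticCocycle.measurable_dobrushinCoeff (hΨn n)
      (BistochasticCocycle.measurable_forwardProduct θ.measurable hΨm n)
  have hκtop : ∀ n ω, BistochasticCocycle.dobrushinCoeff
      (BistochasticCocycle.forwardProduct Ψ θ n ω) ≠ ⊤ := fun n ω =>
    ((hΨn n ω).dobrushinCoeff_le_one.trans_lt ENNReal.one_lt_top).ne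
  obtain ⟨L, hL⟩ := BistochasticCocycle.exists_ae_tendsto_superadditive hθ
    (fun n => BistochasticCocycle.measurable_negLog.comp (hκm n))
    (BistochasticCocycle.isSuperadditiveCocycle_negLog_dobrushinCoeff hΨ)
  have hEL := BistochasticCocycle.lintegral_negLog_hsCoeff_le_exponent hd hθ hΨ hΨm hL
  have hE : BistochasticCocycle.nonposExpectation P
      (fun ω => ENNReal.log (BistochasticCocycle.hsCoeff (Φ ω))) =
      -((∫⁻ ω, BistochasticCocycle.negLog (BistochasticCocycle.hsCoeff (Ψ ω)) ∂P : ℝ≥0∞) :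
        EReal) := by
    have : ∫⁻ ω, BistochasticCocycle.negLog (BistochasticCocycle.hsCoeff (Ψ ω)) ∂P =
        ∫⁻ ω, BistochasticCocycle.negLog (BistochasticCocycle.hsCoeff (Φ ω)) ∂P :=
      lintegral_congr_ae (hΨΦ.mono fun ω hω => by simp only [hω])
    rw [this]
    rfl
  have hE0 : 0 < ∫⁻ ω, BistochasticCocycle.negLog (BistochasticCocycle.hsCoeff (Ψ ω)) ∂P := by
    rw [hE, EReal.neg_lt_comm, neg_zero] at hneg
    exact_mod_cast hneg
  have hforward : ∀ b : ℝ, ENNReal.ofReal b < L → ∃ C : Ω → ℝ, Measurable C ∧ (∀ ω, 0 ≤ C ω) ∧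
      ∀ᵐ ω ∂P, ∀ n : ℕ, BistochasticCocycle.oneToOneNorm
        (BistochasticCocycle.forwardProduct Φ θ n ω -
          BistochasticCocycle.replacement (BistochasticCocycle.maxMixed d)) ≤
        ENNReal.ofReal (C ω * Real.exp (-b * n)) := by
    intro b hb
    obtain ⟨C, hCm, hC0, hC⟩ := BistochasticCocycle.exists_measurable_exponential_bound hκm hκtop
      (hL.mono fun ω hω => BistochasticCocycle.eventually_le_exp_of_eventually_lt_negLog_div
        (fun n => (hΨn n ω).dobrushinCoeff_le_one) (hω.eventually_const_lt hb))
    refine ⟨fun ω => BistochasticCocycle.depolarizingConst d * C ω, hCm.const_mul _,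
      fun ω => mul_nonneg (BistochasticCocycle.depolarizingConst_nonneg d) (hC0 ω), ?_⟩
    filter_upwards [hC, hfwd] with ω hω hω' n
    rw [← hω']
    exact (hΨn n ω).oneToOneNorm_sub_replacement_le_ofReal hd (hω n)
  have hbackward : ∀ b : ℝ, ENNReal.ofReal b <
      ∫⁻ ω, BistochasticCocycle.negLog (BistochasticCocycle.hsCoeff (Ψ ω)) ∂P →
      ∃ C : Ω → ℝ, Measurable C ∧ (∀ ω, 0 ≤ C ω) ∧
      ∀ᵐ ω ∂P, ∀ n : ℕ, BistochasticCocycle.oneToOneNorm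
        (BistochasticCocycle.forwardProduct Φ θ n (θ.symm^[n] ω) -
          BistochasticCocycle.replacement (BistochasticCocycle.maxMixed d)) ≤
        ENNReal.ofReal (C ω * Real.exp (-b * n)) := by
    intro b hb
    obtain ⟨C, hCm, hC0, hC⟩ := BistochasticCocycle.exists_measurable_exponential_bound
      (fun n => (hκm n).comp (θ.symm.measurable.iterate n)) (fun n ω => hκtop n _)
      (BistochasticCocycle.ae_eventually_dobrushinCoeff_backward_le hd hθ hΨ hΨm hb)
    refine ⟨fun ω => BistochasticCocycle.depolarizingConst d * C ω, hCm.const_mul _,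
      fun ω => mul_nonneg (BistochasticCocycle.depolarizingConst_nonneg d) (hC0 ω), ?_⟩
    filter_upwards [hC, hbwd] with ω hω hω' n
    rw [← hω']
    exact (hΨn n _).oneToOneNorm_sub_replacement_le_ofReal hd (hω n)
  have hmix : BistochasticCocycle.QuenchedExponentialReplacement P Φ θ
      (fun _ => BistochasticCocycle.maxMixed d) := by
    refine ⟨⟨fun i j => measurable_const, fun _ => BistochasticCocycle.maxMixed_mem_states hd,
      hbi.mono fun ω hω => hω.map_maxMixed⟩, ?_⟩
    -- A rate below the integral serves both directions, since the integral is at most `L`.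
    obtain ⟨q, -, hq0, hqE⟩ := ENNReal.lt_iff_exists_rat_btwn.1 hE0
    have hq0' : (0 : ℝ) < q := by simpa using hq0
    obtain ⟨C, hCm, hC0, hC⟩ := hforward q (hqE.trans_le hEL)
    obtain ⟨C', hCm', hC0', hC'⟩ := hbackward q hqE
    refine ⟨-q, by linarith, fun ω => C ω + C' ω, hCm.add hCm', ?_⟩
    filter_upwards [hC, hC'] with ω hω hω' n _
    refine ⟨(hω n).trans ?_, (hω' n).trans ?_⟩ <;> gcongr
    · exact le_add_of_nonneg_right (hC0' ω)
    · exact le_add_of_nonneg_left (hC0 ω)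
  have hlam : (-(L : EReal)) ≤ BistochasticCocycle.nonposExpectation P
      (fun ω => ENNReal.log (BistochasticCocycle.hsCoeff (Φ ω))) := by
    rw [hE, EReal.neg_le_neg_iff]
    exact_mod_cast hEL
  refine ⟨-(L : EReal), ?_, hlam, hlam.trans_lt hneg, hmix,
    fun ρ hρ => hmix.ae_eq_maxMixed hθm hρ, fun β hβ hLβ => ?_⟩
  · filter_upwards [hL, hfwd] with ω hω hω'
    have h := continuous_neg.tendsto _ |>.comp
      ((continuous_coe_ennreal_ereal.tendsto L).comp hω)
    refine h.congr' ?_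
    -- The identity between the two normalized logarithms is used only for `n ≥ 1`, avoiding
    -- division by zero.
    filter_upwards [eventually_ge_atTop 1] with n hn
    rw [← hω', BistochasticCocycle.log_div_natCast (hΨn n ω).dobrushinCoeff_le_one hn]
    rfl
  · have hβL : ENNReal.ofReal (-β) < L := by
      rw [EReal.neg_lt_comm] at hLβ
      have : ((ENNReal.ofReal (-β) : ℝ≥0∞) : EReal) < L := by
        rwa [EReal.coe_ennreal_ofReal, max_eq_left (by linarith)]
      exact_mod_cast this
    obtain ⟨C, hCm, hC0, hC⟩ := hforward (-β) hβL
    refine ⟨C, hCm, ?_⟩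
    filter_upwards [hC] with ω hω n _
    have h := hω n
    rw [neg_neg] at h
    exact ⟨fun σ hσ => BistochasticCocycle.traceNorm_map_state_sub_le hσ
      (mul_nonneg (hC0 ω) (Real.exp_pos _).le) h, h⟩
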